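/- Let $n\ge 0$ and identify $T^*\mathfrak{gl}_n(\mathbb C)$ with $\mathfrak{gl}_n(\mathbb C)\times\mathfrak{gl}_n(\mathbb C)$ by means of the trace pairing, with its Zariski topology and its canonical symplectic form $\omega\big((u,a),(v,b)\big)=\mathrm{tr}(ub)-\mathrm{tr}(va)$. Let $$\Lambda_n=\big\{(x,[y,z])\;:\;x,y,z\in\mathfrak{gl}_n(\mathbb C),\ [x,y]=[x,z]=0\big\}\subset T^*\mathfrak{gl}_n(\mathbb C),$$ endowed with the induced Zariski topology. For a partition $\mu\vdash n$, let $\Lambda_\mu\subset\Lambda_n$ be the set of the pairs $(x,t)\in\Lambda_n$ such that $x$ is diagonalizable and the multiplicities of its pairwise distinct eigenvalues are the parts of $\mu$. Theorem. The irreducible components of $\Lambda_n$ are the closures $\overline{\Lambda_\mu}$ (in $\Lambda_n$) of the sets $\Lambda_\mu$, $\mu\vdash n$, and these closures are pairwise distinct. Each of them has dimension $n^2$. Moreover $\Lambda_n$ is lagrangian in $T^*\mathfrak{gl}_n(\mathbb C)$: each of its irreducible components has dimension $n^2$ and is isotropic, that is, $\omega$ vanishes on the tangent space of its Zariski closure in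 $T^*\mathfrak{gl}_n(\mathbb C)$ at every smooth point. (The dimension of a component is that of its Zariski closure in $T^*\mathfrak{gl}_n(\mathbb C)$, i.e. the Krull dimension of the coordinate ring of that closure.) -/

import Mathlib

noncomputable section

/-- The cotangent space `T^* gl_n(ℂ)`, identified with the pairs of matrices `(x, t)` through the
trace pairing `gl_n × gl_n → ℂ`, `(γ, t) ↦ tr (γ t)`. It carries the Zariski topology (below), not
the product topology. -/
def CotGl (n : ℕ) : Type := Matrix (Fin n) (Fin n) ℂ × Matrix (Fin n) (Fin n) ℂ

namespace CotGl

instance (n : ℕ) : AddCommGroup (CotGl n) :=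
  inferInstanceAs (AddCommGroup (Matrix (Fin n) (Fin n) ℂ × Matrix (Fin n) (Fin n) ℂ))

instance (n : ℕ) : Module ℂ (CotGl n) :=
  inferInstanceAs (Module ℂ (Matrix (Fin n) (Fin n) ℂ × Matrix (Fin n) (Fin n) ℂ))

/-- The base point in `gl_n`. -/
def base {n : ℕ} (p : CotGl n) : Matrix (Fin n) (Fin n) ℂ := p.1

/-- The covector, as a matrix. -/
def fib {n : ℕ} (p : CotGl n) : Matrix (Fin n) (Fin n) ℂ := p.2

/-- Index set of the `2 n ^ 2` affine coordinates on `T^* gl_n`. -/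
abbrev Idx (n : ℕ) : Type := (Fin n × Fin n) ⊕ (Fin n × Fin n)

/-- The affine coordinates (matrix entries) of a point. -/
def coords {n : ℕ} (p : CotGl n) : Idx n → ℂ :=
  Sum.elim (fun ij => p.base ij.1 ij.2) (fun ij => p.fib ij.1 ij.2)

/-- The common zeros in `T^* gl_n` of a set of polynomials in the matrix entries. -/
def zeros {n : ℕ} (S : Set (MvPolynomial (Idx n) ℂ)) : Set (CotGl n) :=
  {p | ∀ f ∈ S, MvPolynomial.eval p.coords f = 0}

/-- The Zariski topology: the closed sets are the zero sets of families of polynomials. -/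
instance zariski (n : ℕ) : TopologicalSpace (CotGl n) :=
  TopologicalSpace.ofClosed {Z | ∃ S : Set (MvPolynomial (Idx n) ℂ), Z = zeros S}
    ⟨{1}, by ext p; simp [zeros]⟩
    (by
      intro A hA
      refine ⟨{f | ∃ S, zeros S ∈ A ∧ f ∈ S}, ?_⟩
      ext p
      constructor
      · rintro h f ⟨S, hS, hf⟩
        exact h _ hS f hf
      · intro h Z hZ
        obtain ⟨S, rfl⟩ := hA hZ
        exact fun f hf => h f ⟨S, hZ, hf⟩)
    (by
      rintro _ ⟨S, rfl⟩ _ ⟨T, rfl⟩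
      refine ⟨{h | ∃ f ∈ S, ∃ g ∈ T, h = f * g}, ?_⟩
      ext p
      constructor
      · rintro (h | h) _ ⟨f, hf, g, hg, rfl⟩
        · simp [h f hf]
        · simp [h g hg]
      · intro h
        by_contra hc
        simp only [Set.mem_union, not_or, zeros, Set.mem_ofPred_eq, not_forall] at hc
        obtain ⟨⟨f, hf, hf0⟩, ⟨g, hg, hg0⟩⟩ := hc
        have := h _ ⟨f, hf, g, hg, rfl⟩
        rw [map_mul] at this
        exact (mul_ne_zero hf0 hg0) this)

theorem isClosed_iff {n : ℕ} (Z : Set (CotGl n)) :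
    IsClosed Z ↔ ∃ S : Set (MvPolynomial (Idx n) ℂ), Z = zeros S := by
  rw [← isOpen_compl_iff]
  change Zᶜᶜ ∈ {Z | ∃ S : Set (MvPolynomial (Idx n) ℂ), Z = zeros S} ↔ _
  rw [compl_compl]
  rfl

/-- The ideal of the polynomials in the matrix entries that vanish on `Z`. -/
def ideal {n : ℕ} (Z : Set (CotGl n)) : Ideal (MvPolynomial (Idx n) ℂ) :=
  MvPolynomial.vanishingIdeal ℂ (coords '' Z)

/-- The dimension of the Zariski closure of `Z`: the Krull dimension of its coordinate ring. -/
def dim {n : ℕ} (Z : Set (CotGl n)) : WithBot ℕ∞ :=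
  ringKrullDim (MvPolynomial (Idx n) ℂ ⧸ ideal Z)

/-- The Zariski tangent space at `p` of the Zariski closure of `Z`: the vectors that are killed by
the differentials at `p` of all polynomials vanishing on `Z`. -/
def tangentSpace {n : ℕ} (Z : Set (CotGl n)) (p : CotGl n) : Submodule ℂ (CotGl n) where
  carrier := {v | ∀ f ∈ ideal Z,
    ∑ i, MvPolynomial.eval p.coords (MvPolynomial.pderiv i f) * v.coords i = 0}
  zero_mem' := by
    intro f _
    refine Finset.sum_eq_zero fun i _ => ?_
    have h : coords (0 : CotGl n) i = 0 := by cases i <;> rfl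
    rw [h, mul_zero]
  add_mem' := by
    intro v w hv hw f hf
    have h : ∀ i, coords (v + w) i = v.coords i + w.coords i := by intro i; cases i <;> rfl
    simp only [h, mul_add, Finset.sum_add_distrib, hv f hf, hw f hf, add_zero]
  smul_mem' := by
    intro c v hv f hf
    have h : ∀ i, coords (c • v) i = c * v.coords i := by intro i; cases i <;> rfl
    simp only [h, mul_left_comm _ c, ← Finset.mul_sum, hv f hf, mul_zero]

/-- The canonical symplectic form of `T^* gl_n`, in the identification given by the trace pairing:
`ω ((u, a), (v, b)) = tr (u b) - tr (v a)`. -/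
def symplecticForm {n : ℕ} (v w : CotGl n) : ℂ :=
  (v.base * w.fib).trace - (w.base * v.fib).trace

/-- An irreducible subset `Z` is isotropic if the symplectic form vanishes on the tangent spaces
of the Zariski closure of `Z` at all its smooth points, i.e. at the points where the dimension of
the Zariski tangent space is the dimension of the variety. -/
def IsIsotropic {n : ℕ} (Z : Set (CotGl n)) : Prop :=
  ∀ p ∈ closure Z, (Module.finrank ℂ (tangentSpace Z p) : WithBot ℕ∞) = dim Z →
    ∀ v ∈ tangentSpace Z p, ∀ w ∈ tangentSpace Z p, symplecticForm v w = 0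

/-- A subset of `T^* gl_n` is lagrangian if all its irreducible components (for the topology
induced by the Zariski topology) are isotropic of dimension `n ^ 2`. -/
def IsLagrangian {n : ℕ} (S : Set (CotGl n)) : Prop :=
  ∀ C ∈ irreducibleComponents S,
    IsIsotropic (Subtype.val '' C) ∧ dim (Subtype.val '' C) = ((n ^ 2 : ℕ) : WithBot ℕ∞)

/-- `Λ_n`: the pairs `(x, [y, z])` with `[x, y] = [x, z] = 0`. -/
def Lambda (n : ℕ) : Set (CotGl n) :=
  {p | ∃ y z : Matrix (Fin n) (Fin n) ℂ, ⁅p.base, y⁆ = 0 ∧ ⁅p.base, z⁆ = 0 ∧ p.fib = ⁅y, z⁆}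

/-- The matrix `x` is diagonalizable, and the multiplicities of its pairwise distinct eigenvalues
are the parts of `μ`. -/
def IsDiagonalizableOfType {n : ℕ} (μ : n.Partition) (x : Matrix (Fin n) (Fin n) ℂ) : Prop :=
  ∃ (g : GL (Fin n) ℂ) (d : Fin n → ℂ),
    x = (g : Matrix (Fin n) (Fin n) ℂ) * Matrix.diagonal d *
      ((g⁻¹ : GL (Fin n) ℂ) : Matrix (Fin n) (Fin n) ℂ) ∧
    (Finset.univ.image d).val.map (fun a => (Finset.univ.filter fun i => d i = a).card) = μ.parts

/-- `Λ_μ`, as a subset of the space `Λ_n`. -/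
def LambdaStratum {n : ℕ} (μ : n.Partition) : Set (Lambda n) :=
  {p | IsDiagonalizableOfType μ p.1.base}

end CotGl

end

/-! Fix an idempotent self-map `b` of `Fin n` whose fibres have the sizes prescribed by `μ`. Up to
conjugation, the centralizer of a diagonalizable x of type `μ` consists of the block matrices for
`b`. If y in it has distinct eigenvalues, x and y are diagonalized together, and [y, z] becomes a
block matrix with zero diagonal. Such y are dense in the centralizer. So the stratum has the closure
of `blockFamily b`, the set of pairs (gDg⁻¹, gTg⁻¹) with D constant exactly on the blocks and T
hollow, and also that of the part where no off-diagonal entry of T inside a block vanishes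
(`ideal_genericBlockFamily`). The parameters (g, D, T) range over an open subset of an affine space
and the parametrization is rational, so the vanishing ideal is prime
(`isPrime_ideal_genericBlockFamily`).

Dimension. Absorbing the diagonal blocks of g into T leaves n² parameters, whence the upper bound
(`dim_blockFamily_le`). For the lower bound, at each generic point the velocities of conjugations,
of changes of D and of changes of T contain an explicit n²-dimensional space
(`exists_isotropic_le_tangentSpace`), and the tangent dimension bounds the dimension
(`le_dim_of_le_finrank_tangentSpace`). The symplectic form vanishes on this space, by the Jacobi
identity and invariance of the trace. Isotropy then spreads to every smooth point of the closure,
because tangent vectors there extend to polynomial vector fields in the kernel of a Jacobian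
(`isIsotropic_of_ideal_eq`).

Density of the strata. View ℂⁿ as a ℂ[X]-module through x, a sum of modules ℂ[X]/(X - c)^e. Replace
each (X - c)^e by the product of X - c - sk over k < e. For almost all s the deformed x is
diagonalizable. These products are nested for a fixed c, so every endomorphism of the module deforms
too: y, z and [y, z] follow x along a curve in Λ (`exists_deformation`).

Hence Λ is a finite union of irreducible closures, all of dimension n². An inclusion between two of
them is an equality. Coincidences among eigenvalues persist in the closure of a stratum
(`exists_charpoly_eq_prod_of_mem_closure`), so two partitions with the same closure are coarsenings
of each other, hence equal. -/

noncomputable section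

/-! ### Zariski closures, vanishing ideals and irreducibility -/

section

open MvPolynomial
namespace CotGl

variable {n : ℕ}

theorem mem_ideal {Z : Set (CotGl n)} {f : MvPolynomial (Idx n) ℂ} :
    f ∈ ideal Z ↔ ∀ p ∈ Z, eval p.coords f = 0 := by
  simp [ideal, mem_vanishingIdeal_iff, aeval_eq_eval]

theorem ideal_anti {Z Z' : Set (CotGl n)} (h : Z ⊆ Z') : ideal Z' ≤ ideal Z := fun _ hf =>
  mem_ideal.2 fun p hp => mem_ideal.1 hf p (h hp)

theorem closure_eq_zeros (Z : Set (CotGl n)) : closure Z = zeros (ideal Z : Set _) := by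
  apply Set.Subset.antisymm
  · exact closure_minimal (fun p hp f hf => mem_ideal.1 hf p hp) ((isClosed_iff _).2 ⟨_, rfl⟩)
  · obtain ⟨S, hS⟩ := (isClosed_iff _).1 (isClosed_closure (s := Z))
    intro p hp
    rw [hS]
    intro f hf
    refine hp f (mem_ideal.2 fun q hq => ?_)
    have := subset_closure hq
    rw [hS] at this
    exact this f hf

theorem mem_closure_iff {Z : Set (CotGl n)} {p : CotGl n} :
    p ∈ closure Z ↔ ∀ f ∈ ideal Z, eval p.coords f = 0 := by
  rw [closure_eq_zeros]; rfl

theorem subset_closure_iff {Z Z' : Set (CotGl n)} :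
    Z ⊆ closure Z' ↔ ideal Z' ≤ ideal Z := by
  constructor
  · exact fun h f hf => mem_ideal.2 fun p hp => mem_closure_iff.1 (h hp) f hf
  · exact fun h p hp => mem_closure_iff.2 fun f hf => mem_ideal.1 (h hf) p hp

theorem ideal_eq_of_subset_closure {Z Z' : Set (CotGl n)} (h : Z ⊆ Z') (h' : Z' ⊆ closure Z) :
    ideal Z' = ideal Z :=
  le_antisymm (ideal_anti h) (subset_closure_iff.1 h')

theorem image_closure (S : Set (CotGl n)) (T : Set S) :
    Subtype.val '' closure T = S ∩ closure (Subtype.val '' T) := by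
  rw [Topology.IsInducing.subtypeVal.closure_eq_preimage_closure_image,
    Subtype.image_preimage_coe]

theorem ideal_image_closure (S : Set (CotGl n)) (T : Set S) :
    ideal (Subtype.val '' closure T) = ideal (Subtype.val '' T) :=
  ideal_eq_of_subset_closure (Set.image_mono subset_closure)
    (by rw [image_closure]; exact Set.inter_subset_right)

theorem isPreirreducible_of_isPrime {Z : Set (CotGl n)} (h : (ideal Z).IsPrime) :
    IsPreirreducible Z := by
  rw [isPreirreducible_iff_isClosed_union_isClosed]
  intro A B hA hB hZ
  obtain ⟨S, rfl⟩ := (isClosed_iff _).1 hA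
  obtain ⟨T, rfl⟩ := (isClosed_iff _).1 hB
  by_contra! hc
  obtain ⟨⟨p, hp, hpS⟩, ⟨q, hq, hqT⟩⟩ := Set.not_subset.1 hc.1, Set.not_subset.1 hc.2
  simp only [zeros, Set.mem_ofPred_eq, not_forall] at hpS hqT
  obtain ⟨f, hf, hfp⟩ := hpS
  obtain ⟨g, hg, hgq⟩ := hqT
  have : f * g ∈ ideal Z := mem_ideal.2 fun r hr => by
    rw [map_mul]
    rcases hZ hr with h | h
    · rw [h f hf, zero_mul]
    · rw [h g hg, mul_zero]
  rcases h.mem_or_mem this with h | h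
  · exact hfp (mem_ideal.1 h p hp)
  · exact hgq (mem_ideal.1 h q hq)

theorem isIrreducible_closure_of_isPrime (S : Set (CotGl n)) (T : Set S)
    (h : (ideal (Subtype.val '' T)).IsPrime) : IsIrreducible (closure T) := by
  rw [isIrreducible_iff_closure]
  refine ⟨?_, ?_⟩
  · by_contra hT
    rw [Set.not_nonempty_iff_eq_empty] at hT
    apply h.ne_top
    rw [hT, Set.image_empty, eq_top_iff]
    exact fun f _ => mem_ideal.2 (by simp)
  · have := isPreirreducible_of_isPrime h
    intro U V hU hV ⟨x, hxT, hxU⟩ ⟨y, hyT, hyV⟩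
    obtain ⟨U', hU', rfl⟩ := isOpen_induced_iff.1 hU
    obtain ⟨V', hV', rfl⟩ := isOpen_induced_iff.1 hV
    obtain ⟨_, ⟨z, hz, rfl⟩, hzU, hzV⟩ := this U' V' hU' hV' ⟨x, ⟨x, hxT, rfl⟩, hxU⟩
      ⟨y, ⟨y, hyT, rfl⟩, hyV⟩
    exact ⟨z, hz, hzU, hzV⟩

end CotGl

end

/-! ### Dimension: Noether normalization and tangent spaces -/

section

open MvPolynomial

/-- Incomparability keeps chains of primes strict when contracted to `R`. Conversely, lying over
starts a lift of a chain of `R` and going up continues it. -/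
theorem ringKrullDim_eq_of_isIntegral_of_injective {R S : Type*} [CommRing R] [CommRing S]
    [Algebra R S] [Algebra.IsIntegral R S] (h : Function.Injective (algebraMap R S)) :
    ringKrullDim S = ringKrullDim R := by
  apply le_antisymm
  · exact Order.krullDim_le_of_strictMono (PrimeSpectrum.comap (algebraMap R S))
      fun I J hIJ => Ideal.IsIntegral.comap_lt_comap hIJ
  · refine iSup_le fun l => ?_
    have := (faithfulSMul_iff_algebraMap_injective R S).2 h
    obtain ⟨P, -, hP, hPl⟩ := Ideal.exists_ideal_over_prime_of_isIntegral (S := S) l.head.asIdeal ⊥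
      (by simp [← RingHom.ker_eq_comap_bot, (RingHom.injective_iff_ker_eq_bot _).1 h])
    obtain ⟨L, hL, -⟩ := Ideal.exists_ltSeries_of_hasGoingUp (S := S) l P
      (lo := ⟨hPl.symm⟩)
    rw [← hL]
    exact le_iSup (fun l : LTSeries (PrimeSpectrum S) => (l.length : WithBot ℕ∞)) L

theorem exists_noether_normalization (k A : Type*) [Field k] [CommRing A] [Nontrivial A]
    [Algebra k A] [Algebra.FiniteType k A] :
    ∃ s, ∃ g : MvPolynomial (Fin s) k →ₐ[k] A, Function.Injective g ∧ g.IsIntegral ∧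
      ringKrullDim A = s := by
  obtain ⟨s, g, hg, hi⟩ := exists_integral_inj_algHom_of_fg k A
  refine ⟨s, g, hg, hi, ?_⟩
  let _ := g.toRingHom.toAlgebra
  have : Algebra.IsIntegral (MvPolynomial (Fin s) k) A := ⟨hi⟩
  rw [ringKrullDim_eq_of_isIntegral_of_injective (R := MvPolynomial (Fin s) k) hg]
  simp

/-- The polynomial ring of a Noether normalization of `A` embeds in `K`, so its number of variables,
which is the dimension of `A`, is at most the transcendence degree. -/
theorem ringKrullDim_le_of_injective_of_trdeg_le {k A K : Type} [Field k] [CommRing A]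
    [Nontrivial A] [Algebra k A] [Algebra.FiniteType k A] [CommRing K] [Algebra k K]
    (φ : A →ₐ[k] K) (hφ : Function.Injective φ) {N : ℕ} (hN : Algebra.trdeg k K ≤ N) :
    ringKrullDim A ≤ (N : WithBot ℕ∞) := by
  obtain ⟨s, g, hg, -, hs⟩ := exists_noether_normalization k A
  rw [hs]
  have h := trdeg_le_of_injective (φ.comp g) (hφ.comp hg)
  rw [MvPolynomial.trdeg_of_isDomain] at h
  have : (s : Cardinal.{0}) ≤ N := by simpa using h.trans hN
  exact_mod_cast this

/-- Take a nonzero relation of minimal degree. Injectivity of `g` makes it nonconstant, so in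
characteristic zero its derivative is nonzero of smaller degree and cannot vanish at `x`. -/
theorem Polynomial.exists_aeval_derivative_ne_zero {R A : Type*} [CommRing R] [IsDomain R]
    [CharZero R] [CommRing A] (g : R →+* A) (hg : Function.Injective g) {x : A}
    (hx : g.IsIntegralElem x) :
    ∃ Q : Polynomial R, Q.eval₂ g x = 0 ∧ Q.derivative.eval₂ g x ≠ 0 := by
  classical
  have hex : ∃ d, ∃ Q : Polynomial R, Q ≠ 0 ∧ Q.eval₂ g x = 0 ∧ Q.natDegree = d := by
    obtain ⟨Q, hQ, hQx⟩ := hx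
    exact ⟨_, Q, hQ.ne_zero, hQx, rfl⟩
  obtain ⟨Q, hQ, hQx, hd⟩ := Nat.find_spec hex
  refine ⟨Q, hQx, fun h => ?_⟩
  have h0 : Q.natDegree ≠ 0 := by
    intro h0
    rw [Polynomial.eq_C_of_natDegree_eq_zero h0, Polynomial.eval₂_C] at hQx
    have := hg (hQx.trans (map_zero g).symm)
    exact hQ (by rw [Polynomial.eq_C_of_natDegree_eq_zero h0, this, Polynomial.C_0])
  have h1 : Q.derivative ≠ 0 := fun h1 =>
    h0 (Polynomial.derivative_eq_zero.1 h1)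
  exact Nat.find_min hex (hd ▸ Polynomial.natDegree_derivative_lt h0) ⟨_, h1, h, rfl⟩

namespace CotGl

variable {n : ℕ}

instance : Module.Finite ℂ (CotGl n) :=
  inferInstanceAs (Module.Finite ℂ (Matrix (Fin n) (Fin n) ℂ × Matrix (Fin n) (Fin n) ℂ))

theorem coords_add (v w : CotGl n) (i : Idx n) : coords (v + w) i = v.coords i + w.coords i := by
  cases i <;> rfl

theorem coords_smul (c : ℂ) (v : CotGl n) (i : Idx n) : coords (c • v) i = c * v.coords i := by
  cases i <;> rfl

theorem coords_zero (i : Idx n) : coords (0 : CotGl n) i = 0 := by cases i <;> rfl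

theorem coords_injective : Function.Injective (coords (n := n)) := by
  intro p q h
  refine Prod.ext ?_ ?_
  · ext i j; exact congrFun h (Sum.inl (i, j))
  · ext i j; exact congrFun h (Sum.inr (i, j))

/-- The value on the tangent vector `v` of the differential of `f` at `q`. -/
def differential (q v : CotGl n) (f : MvPolynomial (Idx n) ℂ) : ℂ :=
  ∑ i, eval q.coords (pderiv i f) * v.coords i

theorem mem_tangentSpace {Z : Set (CotGl n)} {q v : CotGl n} :
    v ∈ tangentSpace Z q ↔ ∀ f ∈ ideal Z, differential q v f = 0 := Iff.rfl

theorem differential_mul (q v : CotGl n) (f g : MvPolynomial (Idx n) ℂ) :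
    differential q v (f * g) =
      eval q.coords f * differential q v g + eval q.coords g * differential q v f := by
  simp only [differential, Finset.mul_sum, ← Finset.sum_add_distrib]
  refine Finset.sum_congr rfl fun i _ => ?_
  simp only [Derivation.leibniz, smul_eq_mul, map_add, map_mul]
  ring

theorem differential_add (q v : CotGl n) (f g : MvPolynomial (Idx n) ℂ) :
    differential q v (f + g) = differential q v f + differential q v g := by
  simp [differential, add_mul, Finset.sum_add_distrib]

theorem differential_C (q v : CotGl n) (c : ℂ) : differential q v (C c) = 0 := by
  simp [differential]

theorem differential_X (q v : CotGl n) (i : Idx n) : differential q v (X i) = v.coords i := by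
  classical
  simp [differential, pderiv_X, Pi.single_apply, apply_ite]

theorem differential_add_right (q v w : CotGl n) (f : MvPolynomial (Idx n) ℂ) :
    differential q (v + w) f = differential q v f + differential q w f := by
  simp [differential, coords_add, mul_add, Finset.sum_add_distrib]

theorem differential_smul_right (q v : CotGl n) (c : ℂ) (f : MvPolynomial (Idx n) ℂ) :
    differential q (c • v) f = c * differential q v f := by
  simp only [differential, coords_smul, Finset.mul_sum, mul_left_comm]

theorem differential_aeval_eq_zero {q v : CotGl n} {σ : Type*}
    {w : σ → MvPolynomial (Idx n) ℂ} (h : ∀ j, differential q v (w j) = 0)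
    (a : MvPolynomial σ ℂ) : differential q v (aeval w a) = 0 := by
  induction a using MvPolynomial.induction_on with
  | C c => simpa [algebraMap_eq] using differential_C q v c
  | add f g hf hg => rw [map_add, differential_add, hf, hg, add_zero]
  | mul_X f i hf => rw [map_mul, differential_mul, hf, aeval_X, h, mul_zero, mul_zero, add_zero]

/-- Chain rule, in the case where the coefficients of `Q` are constant to first order along `v`. -/
theorem differential_eval₂ {q v : CotGl n} {R : Type*} [CommRing R]
    (W : R →+* MvPolynomial (Idx n) ℂ) (hW : ∀ a, differential q v (W a) = 0)
    (x : MvPolynomial (Idx n) ℂ) (Q : Polynomial R) :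
    differential q v (Q.eval₂ W x) =
      eval q.coords (Q.derivative.eval₂ W x) * differential q v x := by
  induction Q using Polynomial.induction_on with
  | C a => simp [hW]
  | add f g hf hg => simp [Polynomial.eval₂_add, differential_add, hf, hg, add_mul]
  | monomial k a h =>
    rw [pow_succ, ← mul_assoc, Polynomial.eval₂_mul, differential_mul, h]
    simp only [Polynomial.derivative_mul, Polynomial.derivative_C, Polynomial.derivative_X_pow,
      Polynomial.eval₂_mul, Polynomial.eval₂_add, Polynomial.eval₂_C, Polynomial.eval₂_X,
      Polynomial.eval₂_pow, Polynomial.derivative_X, map_mul, map_add, map_pow,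
      Polynomial.eval₂_zero, Polynomial.eval₂_one, map_one]
    ring

/-- Lift a Noether normalization to polynomials `w j`. Each matrix entry is a root of a polynomial
over them whose derivative does not vanish identically on `Z`. At a point where none of these
derivatives vanishes, a tangent vector is determined by its `s` pairings with the differentials of
the `w j`, where `s` is the dimension. -/
theorem le_dim_of_le_finrank_tangentSpace {Z : Set (CotGl n)} (hZ : (ideal Z).IsPrime) {N : ℕ}
    (h : ∀ q ∈ Z, N ≤ Module.finrank ℂ (tangentSpace Z q)) : (N : WithBot ℕ∞) ≤ dim Z := by
  have := Ideal.Quotient.nontrivial_iff.2 hZ.ne_top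
  obtain ⟨s, g, hg, hi, hs⟩ := exists_noether_normalization ℂ
    (MvPolynomial (Idx n) ℂ ⧸ ideal Z)
  rw [dim, hs]
  have hlift : ∀ j, ∃ w : MvPolynomial (Idx n) ℂ, Ideal.Quotient.mkₐ ℂ (ideal Z) w = g (X j) :=
    fun j => Ideal.Quotient.mkₐ_surjective ℂ _ _
  choose w hw using hlift
  have hW : ∀ a, Ideal.Quotient.mkₐ ℂ (ideal Z) (aeval w a) = g a := by
    intro a
    have : (Ideal.Quotient.mkₐ ℂ (ideal Z)).comp (aeval w) = g := by ext j; simpa using hw j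
    exact DFunLike.congr_fun this a
  have hE : ∀ (Q : Polynomial (MvPolynomial (Fin s) ℂ)) (f : MvPolynomial (Idx n) ℂ),
      Ideal.Quotient.mk (ideal Z) (Q.eval₂ (aeval w : _ →ₐ[ℂ] _).toRingHom f) =
        Q.eval₂ g.toRingHom (Ideal.Quotient.mk (ideal Z) f) := by
    intro Q f
    rw [Polynomial.hom_eval₂]
    congr 1
    exact RingHom.ext hW
  have hQ : ∀ i : Idx n, ∃ Q : Polynomial (MvPolynomial (Fin s) ℂ),
      Q.eval₂ (aeval w : _ →ₐ[ℂ] _).toRingHom (X i : MvPolynomial (Idx n) ℂ) ∈ ideal Z ∧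
      Q.derivative.eval₂ (aeval w : _ →ₐ[ℂ] _).toRingHom (X i) ∉ ideal Z := by
    intro i
    obtain ⟨Q, h1, h2⟩ := Polynomial.exists_aeval_derivative_ne_zero g.toRingHom hg
      (hi (Ideal.Quotient.mk (ideal Z) (X i)))
    exact ⟨Q, by rwa [← Ideal.Quotient.eq_zero_iff_mem, hE],
      by rwa [← Ideal.Quotient.eq_zero_iff_mem, hE]⟩
  choose Q hQ1 hQ2 using hQ
  -- Primality of the ideal provides a single point of `Z` at which all the derivatives are nonzero.
  have hprod : ∏ i, (Q i).derivative.eval₂ (aeval w : _ →ₐ[ℂ] _).toRingHom (X i) ∉ ideal Z := by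
    intro hmem
    obtain ⟨i, -, hi⟩ := (hZ.prod_mem_iff).1 hmem
    exact hQ2 i hi
  obtain ⟨q, hq, hqne⟩ : ∃ q ∈ Z, eval q.coords
      (∏ i, (Q i).derivative.eval₂ (aeval w : _ →ₐ[ℂ] _).toRingHom (X i)) ≠ 0 := by
    by_contra! hc
    exact hprod (mem_ideal.2 hc)
  rw [map_prod, Finset.prod_ne_zero_iff] at hqne
  let L : tangentSpace Z q →ₗ[ℂ] (Fin s → ℂ) :=
    { toFun := fun v j => differential q v.1 (w j)
      map_add' := fun v v' => by ext j; exact differential_add_right _ _ _ _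
      map_smul' := fun c v => by ext j; exact differential_smul_right _ _ _ _ }
  -- If the differentials of the `w j` kill `v`, differentiating the relation for the i-th
  -- coordinate leaves (derivative at `q`) · `v i` = 0.
  have hL : Function.Injective L := by
    rw [injective_iff_map_eq_zero]
    rintro ⟨v, hv⟩ hv0
    refine Subtype.ext (coords_injective (funext fun i => ?_))
    have h1 := mem_tangentSpace.1 hv _ (hQ1 i)
    rw [differential_eval₂ _ (differential_aeval_eq_zero fun j => congrFun hv0 j),
      differential_X] at h1
    simpa [coords_zero] using (mul_eq_zero.1 h1).resolve_left (hqne i (Finset.mem_univ i))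
  have := LinearMap.finrank_le_finrank_of_injective hL
  rw [Module.finrank_fin_fun] at this
  exact_mod_cast (h q hq).trans this

end CotGl

end

/-! ### Clearing denominators and polynomial curves -/

section

open MvPolynomial

/-- `u` stands for 1/`h`. The numerator and the exponent do not depend on `K`, so they serve both at
complex points and at a generic point in a fraction field. -/
theorem MvPolynomial.exists_numerator {ι B : Type*} [CommRing B] [Algebra ℂ B] (a : ι → B) (h : B)
    (f : MvPolynomial ι ℂ) :
    ∃ (N : B) (k : ℕ), ∀ (K : Type) [CommRing K] [Algebra ℂ K] (ev : B →ₐ[ℂ] K) (u : K),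
      ev h * u = 1 → ev N = ev h ^ k * aeval (fun i => ev (a i) * u) f := by
  induction f using MvPolynomial.induction_on with
  | C c => exact ⟨algebraMap ℂ B c, 0, fun K _ _ ev u _ => by simp⟩
  | add f g hf hg =>
    obtain ⟨N, k, hN⟩ := hf
    obtain ⟨M, l, hM⟩ := hg
    refine ⟨h ^ l * N + h ^ k * M, k + l, fun K _ _ ev u hu => ?_⟩
    simp only [map_add, map_mul, map_pow, hN K ev u hu, hM K ev u hu]
    ring
  | mul_X f i hf =>
    obtain ⟨N, k, hN⟩ := hf
    refine ⟨N * a i, k + 1, fun K _ _ ev u hu => ?_⟩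
    simp only [map_mul, hN K ev u hu, aeval_X]
    linear_combination (ev h ^ k * (aeval (fun i => ev (a i) * u)) f * ev (a i)) * (-hu)

theorem Polynomial.eventually_eval_ne_zero {p : Polynomial ℂ} (hp : p ≠ 0) :
    ∀ᶠ s in Filter.cofinite, p.eval s ≠ 0 := by
  rw [Filter.eventually_cofinite]
  simpa using p.finite_setOfPred_isRoot hp

theorem Polynomial.eq_zero_of_eventually {p : Polynomial ℂ}
    (h : ∀ᶠ s in Filter.cofinite, p.eval s = 0) : p = 0 := by
  by_contra hp
  obtain ⟨s, h1, h2⟩ := (h.and (eventually_eval_ne_zero hp)).exists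
  exact h2 h1

/-- The value at `s` of a matrix of polynomials. -/
abbrev Matrix.evalAt {n : ℕ} (G : Matrix (Fin n) (Fin n) (Polynomial ℂ)) (s : ℂ) :
    Matrix (Fin n) (Fin n) ℂ :=
  G.map (Polynomial.aeval s : Polynomial ℂ →ₐ[ℂ] ℂ)

theorem Matrix.det_evalAt {n : ℕ} (G : Matrix (Fin n) (Fin n) (Polynomial ℂ)) (s : ℂ) :
    (G.evalAt s).det = G.det.eval s := by
  rw [← Polynomial.coe_aeval_eq_eval]
  exact ((Polynomial.aeval s : Polynomial ℂ →ₐ[ℂ] ℂ).toRingHom.map_det G).symm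

namespace CotGl

variable {n : ℕ}

/-- The point with given base and fibre components. -/
def mk (x t : Matrix (Fin n) (Fin n) ℂ) : CotGl n := (x, t)

@[simp] theorem base_mk (x t : Matrix (Fin n) (Fin n) ℂ) : (mk x t).base = x := rfl
@[simp] theorem fib_mk (x t : Matrix (Fin n) (Fin n) ℂ) : (mk x t).fib = t := rfl

theorem mk_base_fib (p : CotGl n) : mk p.base p.fib = p := rfl

/-- The family of all entries of a pair of matrices. -/
def entries {R : Type*} (x t : Matrix (Fin n) (Fin n) R) : Idx n → R :=
  Sum.elim (fun ij => x ij.1 ij.2) (fun ij => t ij.1 ij.2)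

theorem coords_mk (x t : Matrix (Fin n) (Fin n) ℂ) : (mk x t).coords = entries x t := rfl

/-- The inverse is the adjugate over the determinant, so a polynomial in the entries of the
conjugates has a power of the determinant as denominator. -/
theorem exists_numerator_conj {B : Type*} [CommRing B] [Algebra ℂ B]
    (G D T : Matrix (Fin n) (Fin n) B) (f : MvPolynomial (Idx n) ℂ) :
    ∃ (N : B) (k : ℕ), ∀ (K : Type) [Field K] [Algebra ℂ K] (ev : B →ₐ[ℂ] K),
      (G.map ev).det ≠ 0 → ev N = (G.map ev).det ^ k *
        aeval (entries (G.map ev * D.map ev * (G.map ev)⁻¹)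
          (G.map ev * T.map ev * (G.map ev)⁻¹)) f := by
  obtain ⟨N, k, h⟩ := exists_numerator (entries (G * D * G.adjugate) (G * T * G.adjugate)) G.det f
  refine ⟨N, k, fun K _ _ ev hdet => ?_⟩
  have hd : ev G.det = (G.map ev).det := ev.toRingHom.map_det G
  have hm : ∀ P Q : Matrix (Fin n) (Fin n) B, (P * Q).map ev = P.map ev * Q.map ev := fun P Q => by
    ext i j; simp [Matrix.mul_apply]
  have ha : G.adjugate.map ev = (G.map ev).adjugate := ev.toRingHom.map_adjugate G
  have h1 := h K ev (G.map ev).det⁻¹ (by rw [hd, mul_inv_cancel₀ hdet])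
  rw [h1, hd]
  congr 3
  funext i
  have key : ∀ (P : Matrix (Fin n) (Fin n) B) (i j : Fin n),
      ev ((G * P * G.adjugate) i j) * (G.map ev).det⁻¹ =
        (G.map ev * P.map ev * (G.map ev)⁻¹) i j := by
    intro P i j
    rw [Matrix.inv_def, Ring.inverse_eq_inv', Matrix.mul_smul, Matrix.smul_apply, ← ha, ← hm, ← hm,
      Matrix.map_apply, smul_eq_mul, mul_comm]
  rcases i with ⟨i, j⟩ | ⟨i, j⟩ <;> exact key _ _ _

theorem exists_numerator_evalAt (G D T : Matrix (Fin n) (Fin n) (Polynomial ℂ))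
    (f : MvPolynomial (Idx n) ℂ) :
    ∃ (N : Polynomial ℂ) (k : ℕ), ∀ s, (G.evalAt s).det ≠ 0 → N.eval s = (G.evalAt s).det ^ k *
      eval (mk (G.evalAt s * D.evalAt s * (G.evalAt s)⁻¹)
        (G.evalAt s * T.evalAt s * (G.evalAt s)⁻¹)).coords f := by
  obtain ⟨N, k, hN⟩ := exists_numerator_conj G D T f
  refine ⟨N, k, fun s hs => ?_⟩
  rw [← Polynomial.coe_aeval_eq_eval, coords_mk, ← aeval_eq_eval]
  exact hN ℂ (Polynomial.aeval s) hs

/-- The numerator is a polynomial in the parameter with cofinitely many zeros, hence zero; this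
gives the value at the exceptional parameters where the determinant is nonzero. -/
theorem eval_conj_eq_zero_of_eventually {G D T : Matrix (Fin n) (Fin n) (Polynomial ℂ)}
    {f : MvPolynomial (Idx n) ℂ}
    (h : ∀ᶠ s in Filter.cofinite, (G.evalAt s).det ≠ 0 →
      eval (mk (G.evalAt s * D.evalAt s * (G.evalAt s)⁻¹)
        (G.evalAt s * T.evalAt s * (G.evalAt s)⁻¹)).coords f = 0) (s : ℂ)
    (hs : (G.evalAt s).det ≠ 0) :
      eval (mk (G.evalAt s * D.evalAt s * (G.evalAt s)⁻¹)
        (G.evalAt s * T.evalAt s * (G.evalAt s)⁻¹)).coords f = 0 := by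
  obtain ⟨N, k, hN⟩ := exists_numerator_evalAt G D T f
  have hG : G.det ≠ 0 := by
    intro h0
    rw [Matrix.det_evalAt, h0, Polynomial.eval_zero] at hs
    exact hs rfl
  have hN0 : N = 0 := by
    apply Polynomial.eq_zero_of_eventually
    filter_upwards [h, Polynomial.eventually_eval_ne_zero hG] with t ht hdt
    rw [← Matrix.det_evalAt] at hdt
    rw [hN t hdt, ht hdt, mul_zero]
  have := hN s hs
  rw [hN0, Polynomial.eval_zero] at this
  exact (mul_eq_zero.1 this.symm).resolve_left (pow_ne_zero _ hs)

theorem eval_entries_aeval (x t : Matrix (Fin n) (Fin n) (Polynomial ℂ))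
    (f : MvPolynomial (Idx n) ℂ) (s : ℂ) :
    (aeval (entries x t) f).eval s =
      eval (mk (x.evalAt s) (t.evalAt s)).coords f := by
  rw [← Polynomial.coe_aeval_eq_eval, ← aeval_eq_eval, ← AlgHom.comp_apply]
  congr 1
  ext i
  rcases i with ⟨i, j⟩ | ⟨i, j⟩ <;> simp [entries, coords]

theorem aeval_entries_eq_zero {x t : Matrix (Fin n) (Fin n) (Polynomial ℂ)}
    {f : MvPolynomial (Idx n) ℂ} (h : ∀ᶠ s in Filter.cofinite,
      eval (mk (x.evalAt s) (t.evalAt s)).coords f = 0) :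
    aeval (entries x t) f = 0 :=
  Polynomial.eq_zero_of_eventually (by simpa only [eval_entries_aeval] using h)

theorem eval_eq_zero_of_eventually {x t : Matrix (Fin n) (Fin n) (Polynomial ℂ)}
    {f : MvPolynomial (Idx n) ℂ} (h : ∀ᶠ s in Filter.cofinite,
      eval (mk (x.evalAt s) (t.evalAt s)).coords f = 0) (s : ℂ) :
    eval (mk (x.evalAt s) (t.evalAt s)).coords f = 0 := by
  rw [← eval_entries_aeval, aeval_entries_eq_zero h, Polynomial.eval_zero]

theorem eval_derivative_aeval {c : Idx n → Polynomial ℂ} {q v : CotGl n}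
    (hq : ∀ i, (c i).eval 0 = q.coords i) (hv : ∀ i, (c i).derivative.eval 0 = v.coords i)
    (f : MvPolynomial (Idx n) ℂ) :
    (aeval c f).derivative.eval 0 = differential q v f := by
  have h0 : ∀ f : MvPolynomial (Idx n) ℂ, (aeval c f).eval 0 = eval q.coords f := by
    intro f
    rw [← Polynomial.coe_aeval_eq_eval, ← aeval_eq_eval, ← AlgHom.comp_apply]
    congr 1
    ext i
    simp [← hq, Polynomial.coe_aeval_eq_eval]
  induction f using MvPolynomial.induction_on with
  | C c => simp [differential_C]
  | add f g hf hg => simp [differential_add, hf, hg]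
  | mul_X f i hf =>
    simp only [map_mul, aeval_X, Polynomial.derivative_mul, Polynomial.eval_add,
      Polynomial.eval_mul, hf, hq, hv, h0, differential_mul, differential_X, eval_X]
    ring

/-- A velocity vector of a polynomial curve that lies in the closure of `Z` is tangent to `Z`. -/
theorem mem_tangentSpace_of_curve {Z : Set (CotGl n)} {q v : CotGl n}
    (x t : Matrix (Fin n) (Fin n) (Polynomial ℂ))
    (h : ∀ᶠ s in Filter.cofinite,
      mk (x.evalAt s) (t.evalAt s) ∈ closure Z)
    (hqx : x.map (Polynomial.eval 0) = q.base) (hqt : t.map (Polynomial.eval 0) = q.fib)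
    (hvx : x.map (fun p => p.derivative.eval 0) = v.base)
    (hvt : t.map (fun p => p.derivative.eval 0) = v.fib) : v ∈ tangentSpace Z q := by
  rw [mem_tangentSpace]
  intro f hf
  rw [← eval_derivative_aeval (c := entries x t), aeval_entries_eq_zero, Polynomial.derivative_zero,
    Polynomial.eval_zero]
  · exact h.mono fun s hs => mem_closure_iff.1 hs f hf
  · rintro (⟨i, j⟩ | ⟨i, j⟩)
    · exact congrFun (congrFun hqx i) j
    · exact congrFun (congrFun hqt i) j
  · rintro (⟨i, j⟩ | ⟨i, j⟩)
    · exact congrFun (congrFun hvx i) j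
    · exact congrFun (congrFun hvt i) j

end CotGl

end

/-! ### Isotropy at all smooth points from isotropy on a dense set -/

section

open MvPolynomial

namespace CotGl

variable {n : ℕ}

theorem finrank_cotGl : Module.finrank ℂ (CotGl n) = 2 * n ^ 2 := by
  change Module.finrank ℂ (Matrix (Fin n) (Fin n) ℂ × Matrix (Fin n) (Fin n) ℂ) = _
  rw [Module.finrank_prod, Module.finrank_matrix]
  simp; ring

/-- The vector with given coordinates. -/
def ofCoords (c : Idx n → ℂ) : CotGl n :=
  mk (Matrix.of fun i j => c (Sum.inl (i, j))) (Matrix.of fun i j => c (Sum.inr (i, j)))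

theorem coords_ofCoords (c : Idx n → ℂ) (i : Idx n) : (ofCoords c).coords i = c i := by
  rcases i with ⟨i, j⟩ | ⟨i, j⟩ <;> rfl

theorem ofCoords_coords (v : CotGl n) : ofCoords v.coords = v := rfl

/-- The canonical symplectic form in coordinates, over any ring. -/
def coordForm {R : Type*} [CommRing R] (c d : Idx n → R) : R :=
  ∑ i, ∑ j, (c (Sum.inl (i, j)) * d (Sum.inr (j, i)) - d (Sum.inl (i, j)) * c (Sum.inr (j, i)))

theorem symplecticForm_eq_coordForm (v w : CotGl n) :
    symplecticForm v w = coordForm v.coords w.coords := by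
  simp [symplecticForm, coordForm, Matrix.trace, Matrix.mul_apply, coords]

theorem map_coordForm {R S : Type*} [CommRing R] [CommRing S] (φ : R →+* S) (c d : Idx n → R) :
    φ (coordForm c d) = coordForm (fun i => φ (c i)) (fun i => φ (d i)) := by
  simp [coordForm]

/-- The differential at `q` of `f`, as a linear form. -/
def differentialₗ (q : CotGl n) (f : MvPolynomial (Idx n) ℂ) :
    Module.Dual ℂ (CotGl n) where
  toFun v := differential q v f
  map_add' v w := differential_add_right q v w f
  map_smul' c v := differential_smul_right q v c f

/-- The Jacobian map at `q` of a tuple of polynomials. -/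
def jacobian {r : ℕ} (f : Fin r → MvPolynomial (Idx n) ℂ) (q : CotGl n) :
    CotGl n →ₗ[ℂ] (Fin r → ℂ) :=
  LinearMap.pi fun k => differentialₗ q (f k)

/-- The tangent space is the common kernel of the differentials of the ideal, so these span a space
of dimension `r`. A basis can be chosen among the differentials themselves. -/
theorem exists_jacobian_surjective {Z : Set (CotGl n)} {p : CotGl n} {r : ℕ}
    (h : Module.finrank ℂ (tangentSpace Z p) + r = 2 * n ^ 2) :
    ∃ f : Fin r → MvPolynomial (Idx n) ℂ, (∀ k, f k ∈ ideal Z) ∧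
      Function.Surjective (jacobian f p) := by
  set s : Set (Module.Dual ℂ (CotGl n)) := differentialₗ p '' (ideal Z : Set _) with hs
  have hco : (Submodule.span ℂ s).dualCoannihilator = tangentSpace Z p := by
    ext v
    rw [Submodule.mem_dualCoannihilator, mem_tangentSpace]
    constructor
    · exact fun hv f hf => hv _ (Submodule.subset_span ⟨f, hf, rfl⟩)
    · intro hv φ hφ
      induction hφ using Submodule.span_induction with
      | mem φ hφ => obtain ⟨f, hf, rfl⟩ := hφ; exact hv f hf
      | zero => rfl
      | add φ ψ _ _ h1 h2 => rw [LinearMap.add_apply, h1, h2, add_zero]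
      | smul c φ _ h1 => rw [LinearMap.smul_apply, h1, smul_zero]
  have hdim := Subspace.finrank_add_finrank_dualCoannihilator_eq (Submodule.span ℂ s)
  rw [hco, finrank_cotGl] at hdim
  have hr : Module.finrank ℂ (Submodule.span ℂ s) = r := by omega
  have hex := Submodule.exists_fun_fin_finrank_span_eq ℂ s
  rw [hr] at hex
  obtain ⟨φ, hφs, hφspan, -⟩ := hex
  choose f hf hfφ using hφs
  refine ⟨f, hf, ?_⟩
  have hker : LinearMap.ker (jacobian f p) = tangentSpace Z p := by
    rw [← hco, ← hφspan]
    ext v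
    rw [Submodule.mem_dualCoannihilator, LinearMap.mem_ker]
    constructor
    · intro hv φ' hφ'
      induction hφ' using Submodule.span_induction with
      | mem φ' hφ' =>
        obtain ⟨k, rfl⟩ := hφ'
        rw [← hfφ]
        exact congrFun hv k
      | zero => rfl
      | add φ ψ _ _ h1 h2 => rw [LinearMap.add_apply, h1, h2, add_zero]
      | smul c φ _ h1 => rw [LinearMap.smul_apply, h1, smul_zero]
    · intro hv
      ext k
      have := hv (φ k) (Submodule.subset_span ⟨k, rfl⟩)
      rw [← hfφ] at this
      exact this
  rw [← LinearMap.range_eq_top]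
  apply Submodule.eq_top_of_finrank_eq
  have := LinearMap.finrank_range_add_finrank_ker (jacobian f p)
  rw [hker, finrank_cotGl] at this
  rw [Module.finrank_fin_fun]
  omega

theorem jacobian_ofCoords {r : ℕ} (f : Fin r → MvPolynomial (Idx n) ℂ) (q : CotGl n)
    (c : Idx n → ℂ) :
    jacobian f q (ofCoords c) =
      (Matrix.of fun k i => eval q.coords (pderiv i (f k))).mulVec c := by
  ext k
  change differential q (ofCoords c) (f k) = _
  simp only [differential, coords_ofCoords]
  rfl

/-- Tangent vectors at the smooth point `p` are extended to polynomial vector fields in the kernel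
of a Jacobian of rank n² at `p`. Where that rank persists on `G`, the kernel has dimension n² and is
therefore `W`. So the form of two such fields vanishes on a dense part of `Z`, hence at `p`. -/
theorem isIsotropic_of_ideal_eq {Z G : Set (CotGl n)} (hI : ideal G = ideal Z)
    (hdim : dim Z = ((n ^ 2 : ℕ) : WithBot ℕ∞))
    (hG : ∀ q ∈ G, ∃ W : Submodule ℂ (CotGl n), W ≤ tangentSpace Z q ∧
      n ^ 2 ≤ Module.finrank ℂ W ∧ ∀ v ∈ W, ∀ w ∈ W, symplecticForm v w = 0) :
    IsIsotropic Z := by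
  intro p hp hpdim v hv w hw
  rw [hdim] at hpdim
  have hpdim' : Module.finrank ℂ (tangentSpace Z p) = n ^ 2 := by exact_mod_cast hpdim
  obtain ⟨f, hf, hsurj⟩ := exists_jacobian_surjective (Z := Z) (p := p) (r := n ^ 2) (by omega)
  set J : Matrix (Fin (n ^ 2)) (Idx n) (MvPolynomial (Idx n) ℂ) :=
    Matrix.of fun k i => pderiv i (f k) with hJ
  have hJq : ∀ (q : CotGl n) (c : Idx n → ℂ), jacobian f q (ofCoords c) =
      (J.map (eval q.coords)).mulVec c := fun q c => jacobian_ofCoords f q c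
  -- A right inverse of the Jacobian at `p`, kept constant. Then `M` = `J * R'` is the identity at
  -- `p`, and its determinant detects points where `J` still has full rank.
  obtain ⟨R, hR⟩ : ∃ R : Matrix (Idx n) (Fin (n ^ 2)) ℂ, J.map (eval p.coords) * R = 1 := by
    rw [← Matrix.mulVec_surjective_iff_exists_right_inverse]
    intro y
    obtain ⟨u, hu⟩ := hsurj y
    exact ⟨u.coords, by rw [← hJq, ofCoords_coords, hu]⟩
  set R' : Matrix (Idx n) (Fin (n ^ 2)) (MvPolynomial (Idx n) ℂ) := R.map C with hR'
  set M : Matrix (Fin (n ^ 2)) (Fin (n ^ 2)) (MvPolynomial (Idx n) ℂ) := J * R' with hM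
  have hMq : ∀ q : CotGl n, M.map (eval q.coords) = J.map (eval q.coords) * R := by
    intro q
    rw [hM, Matrix.map_mul, hR', Matrix.map_map]
    congr 1
    ext i j
    simp
  have hdetq : ∀ q : CotGl n, eval q.coords M.det = (J.map (eval q.coords) * R).det := by
    intro q
    rw [← hMq]
    exact (eval q.coords).map_det M
  -- Up to the factor `M.det`, the projection u - R M⁻¹ J u onto the kernel of `J`. Writing M⁻¹
  -- through the adjugate makes it polynomial.
  let X : CotGl n → Idx n → MvPolynomial (Idx n) ℂ := fun u =>
    M.det • (fun i => C (u.coords i)) -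
      R'.mulVec (M.adjugate.mulVec (J.mulVec fun i => C (u.coords i)))
  have hJX : ∀ u, J.mulVec (X u) = 0 := by
    intro u
    simp only [X]
    rw [Matrix.mulVec_sub, Matrix.mulVec_smul, Matrix.mulVec_mulVec, ← hM, Matrix.mulVec_mulVec,
      Matrix.mul_adjugate, Matrix.smul_mulVec, Matrix.one_mulVec, sub_self]
  let Xq : CotGl n → CotGl n → CotGl n := fun q u => ofCoords fun i => eval q.coords (X u i)
  have hker : ∀ q u, jacobian f q (Xq q u) = 0 := by
    intro q u
    rw [hJq]
    have := congrArg (fun y : Fin (n ^ 2) → MvPolynomial (Idx n) ℂ => fun k => eval q.coords (y k))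
      (hJX u)
    ext k
    have hk := congrFun this k
    simpa [Matrix.mulVec, dotProduct] using hk
  set F := coordForm (X v) (X w) with hF
  have hFq : ∀ q : CotGl n, eval q.coords F = symplecticForm (Xq q v) (Xq q w) := by
    intro q
    rw [hF, map_coordForm, symplecticForm_eq_coordForm]
    rfl
  -- The factor `M.det` disposes of the points where the rank may drop; it equals 1 at `p`.
  have hmem : F * M.det ∈ ideal Z := by
    rw [← hI, mem_ideal]
    intro q hq
    rw [map_mul]
    by_cases hd : eval q.coords M.det = 0
    · rw [hd, mul_zero]
    obtain ⟨W, hWT, hWdim, hW⟩ := hG q hq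
    have hsurjq : Function.Surjective (jacobian f q) := by
      intro y
      have hu : IsUnit (J.map (eval q.coords) * R).det := by
        rw [← hdetq]; exact isUnit_iff_ne_zero.2 hd
      refine ⟨ofCoords (R.mulVec ((J.map (eval q.coords) * R)⁻¹.mulVec y)), ?_⟩
      rw [hJq, Matrix.mulVec_mulVec, Matrix.mulVec_mulVec, Matrix.mul_nonsing_inv _ hu,
        Matrix.one_mulVec]
    have hWker : W ≤ LinearMap.ker (jacobian f q) := fun u hu =>
      LinearMap.mem_ker.2 (funext fun k => mem_tangentSpace.1 (hWT hu) _ (hf k))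
    have heq : W = LinearMap.ker (jacobian f q) := by
      apply Submodule.eq_of_le_of_finrank_le hWker
      have := LinearMap.finrank_range_add_finrank_ker (jacobian f q)
      rw [LinearMap.range_eq_top.2 hsurjq, finrank_top, Module.finrank_fin_fun, finrank_cotGl]
        at this
      omega
    rw [hFq, hW _ (heq ▸ hker q v) _ (heq ▸ hker q w), zero_mul]
  have hdetp : eval p.coords M.det = 1 := by rw [hdetq, hR, Matrix.det_one]
  have hXp : ∀ u ∈ tangentSpace Z p, Xq p u = u := by
    intro u hu
    have hJu : (J.map (eval p.coords)).mulVec u.coords = 0 := by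
      rw [← hJq, ofCoords_coords]
      exact funext fun k => mem_tangentSpace.1 hu _ (hf k)
    have hJu' : (fun k => eval p.coords (J.mulVec (fun i => C (u.coords i)) k)) = 0 := by
      rw [← hJu]
      ext k
      simp [Matrix.mulVec, dotProduct]
    have : (fun i => eval p.coords (X u i)) = u.coords := by
      ext i
      simp only [X, Pi.sub_apply, Pi.smul_apply, smul_eq_mul, map_sub, map_mul, hdetp, one_mul,
        eval_C]
      rw [sub_eq_self]
      simp only [Matrix.mulVec, dotProduct, map_sum, map_mul]
      refine Finset.sum_eq_zero fun k _ => ?_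
      rw [Finset.sum_eq_zero, mul_zero]
      intro l _
      have := congrFun hJu' l
      simp only [Matrix.mulVec, dotProduct, map_sum, map_mul, Pi.zero_apply] at this
      rw [this, mul_zero]
    simp only [Xq]
    rw [this, ofCoords_coords]
  have hfin := mem_closure_iff.1 hp _ hmem
  rw [map_mul, hdetp, mul_one, hFq, hXp v hv, hXp w hw] at hfin
  exact hfin

end CotGl

end

/-! ### Diagonalization and separable characteristic polynomials -/

section

namespace Matrix

variable {n : ℕ}

/-- A squarefree annihilating polynomial makes the endomorphism semisimple. Over ℂ the eigenspaces
then span, and `g` has a basis of eigenvectors as columns. -/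
theorem exists_eq_conj_diagonal_of_squarefree (x : Matrix (Fin n) (Fin n) ℂ) {P : Polynomial ℂ}
    (hP : Squarefree P) (hx : Polynomial.aeval x P = 0) :
    ∃ (g : Matrix (Fin n) (Fin n) ℂ) (d : Fin n → ℂ), g.det ≠ 0 ∧ x = g * diagonal d * g⁻¹ := by
  classical
  set f : Module.End ℂ (Fin n → ℂ) := toLin' x
  have hss : f.IsSemisimple := by
    refine Module.End.isSemisimple_of_squarefree_aeval_eq_zero hP ?_
    have := Polynomial.aeval_algHom_apply (toLinAlgEquiv' (R := ℂ) (n := Fin n)).toAlgHom x P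
    rw [hx, map_zero] at this
    exact this
  have hint := DirectSum.isInternal_submodule_of_iSupIndep_of_iSup_eq_top
    f.eigenspaces_iSupIndep hss.iSup_eigenspace_eq_top
  let b := hint.collectedBasis fun μ => Module.finBasis ℂ (f.eigenspace μ)
  let e := b.indexEquiv (Pi.basisFun ℂ (Fin n))
  let b' := b.reindex e
  let d : Fin n → ℂ := fun j => (e.symm j).1
  let g : Matrix (Fin n) (Fin n) ℂ := (Pi.basisFun ℂ (Fin n)).toMatrix b'
  have hg : IsUnit g.det := by
    rw [← isUnit_iff_isUnit_det]
    exact (Units.mkOfMulEqOne _ _ ((Pi.basisFun ℂ (Fin n)).toMatrix_mul_toMatrix_flip b')).isUnit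
  have hfx : ∀ v, f v = x.mulVec v := toLin'_apply x
  have hb : ∀ j, x.mulVec (b' j) = d j • b' j := by
    intro j
    have := hint.collectedBasis_mem (fun μ => Module.finBasis ℂ (f.eigenspace μ)) (e.symm j)
    rw [Module.End.mem_eigenspace_iff, hfx] at this
    simpa [b', b, d] using this
  have hxg : x * g = g * diagonal d := by
    ext i j
    have := congrFun (hb j) i
    simp only [Pi.smul_apply, smul_eq_mul, mulVec, dotProduct] at this
    rw [mul_diagonal, mul_apply]
    simp only [g, Module.Basis.toMatrix_apply, Pi.basisFun_repr]
    rw [this, mul_comm]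
  exact ⟨g, d, hg.ne_zero, by rw [← hxg, mul_assoc, mul_nonsing_inv _ hg, mul_one]⟩

/-- The discriminant, as a resultant with the derivative, is a polynomial in the parameter that is
nonzero at `s₀`. -/
theorem eventually_squarefree_charpoly (Y : Matrix (Fin n) (Fin n) (Polynomial ℂ)) {s₀ : ℂ}
    (h : (Y.evalAt s₀).charpoly.Separable) :
    ∀ᶠ s in Filter.cofinite, (Y.evalAt s).charpoly.Separable := by
  set χ := Y.charpoly with hχ
  have hmap : ∀ s, χ.map (Polynomial.evalRingHom s) =
      (Y.evalAt s).charpoly := fun s =>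
    by
    rw [hχ, ← charpoly_map]
    congr 1
  -- The formal degrees n and n - 1 are fixed, so that the resultant commutes with evaluation at
  -- `s`.
  have hres : ∀ s, (Polynomial.resultant χ χ.derivative n (n - 1)).eval s =
      Polynomial.resultant (Y.evalAt s).charpoly
        (Y.evalAt s).charpoly.derivative := by
    intro s
    have h1 : (Y.evalAt s).charpoly.natDegree = n := by simp
    rw [Polynomial.natDegree_derivative, h1, ← hmap, Polynomial.derivative_map,
      Polynomial.resultant_map_map]
    simp
  have hne : Polynomial.resultant χ χ.derivative n (n - 1) ≠ 0 := by
    intro h0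
    have := hres s₀
    rw [h0, Polynomial.eval_zero] at this
    exact Polynomial.resultant_ne_zero _ _ h this.symm
  filter_upwards [Polynomial.eventually_eval_ne_zero hne] with s hs
  rw [hres] at hs
  exact (Polynomial.isUnit_resultant_iff_isCoprime (charpoly_monic _)).1 (isUnit_iff_ne_zero.2 hs)

end Matrix

end

/-! ### Partitions as fibre sizes of maps -/

section

/-- The cardinalities of the nonempty fibres of a map. -/
def fiberCards {n : ℕ} {α : Type*} [DecidableEq α] (d : Fin n → α) : Multiset ℕ :=
  (Finset.univ.image d).val.map fun a => (Finset.univ.filter fun i => d i = a).card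

theorem fiberCards_eq_dedup {n : ℕ} {α : Type*} [DecidableEq α] (d : Fin n → α) :
    fiberCards d = (Finset.univ.val.map d).dedup.map fun a => (Finset.univ.val.map d).count a := by
  rw [fiberCards, Finset.image_val]
  refine Multiset.map_congr rfl fun a _ => ?_
  rw [Multiset.count_map, Finset.card_def, Finset.filter_val]
  simp only [eq_comm]

theorem fiberCards_comp_of_injOn {n : ℕ} {α β : Type*} [DecidableEq α] [DecidableEq β]
    (d : Fin n → α) (e : α → β) (he : Set.InjOn e (Set.range d)) :
    fiberCards (e ∘ d) = fiberCards d := by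
  rw [fiberCards, fiberCards, ← Finset.image_image, Finset.image_val_of_injOn, Multiset.map_map]
  · refine Multiset.map_congr rfl fun a ha => ?_
    simp only [Finset.mem_val, Finset.mem_image, Finset.mem_univ, true_and] at ha
    obtain ⟨j, rfl⟩ := ha
    simp only [Function.comp_apply]
    congr 1
    ext i
    simpa using ⟨fun h => he ⟨i, rfl⟩ ⟨j, rfl⟩ h, fun h => congrArg e h⟩
  · simpa using he

theorem card_fiberCards {n : ℕ} {α : Type*} [DecidableEq α] (d : Fin n → α) :
    (fiberCards d).card = (Finset.univ.image d).card := by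
  rw [fiberCards, Multiset.card_map, Finset.card_def]

theorem card_fiberCards_comp_le {n : ℕ} {α β : Type*} [DecidableEq α] [DecidableEq β]
    (d : Fin n → α) (e : α → β) : (fiberCards (e ∘ d)).card ≤ (fiberCards d).card := by
  rw [card_fiberCards, card_fiberCards, ← Finset.image_image]
  exact Finset.card_image_le

/-- Composing with `e` can only merge fibres. If their number does not drop, `e` is injective on the
values of `d`. -/
theorem fiberCards_comp_of_card_le {n : ℕ} {α β : Type*} [DecidableEq α] [DecidableEq β]
    (d : Fin n → α) (e : α → β) (h : (fiberCards d).card ≤ (fiberCards (e ∘ d)).card) :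
    fiberCards (e ∘ d) = fiberCards d := by
  apply fiberCards_comp_of_injOn
  rw [card_fiberCards, card_fiberCards, ← Finset.image_image] at h
  have := Finset.injOn_of_card_image_eq (le_antisymm Finset.card_image_le h)
  simpa using this

theorem exists_equiv_of_map_eq {X Y K : Type*} [Fintype X] [Fintype Y] [DecidableEq K]
    (f : X → K) (g : Y → K) (h : Finset.univ.val.map f = Finset.univ.val.map g) :
    ∃ e : X ≃ Y, ∀ x, g (e x) = f x := by
  have hc : ∀ k, Nonempty ({x // f x = k} ≃ {y // g y = k}) := by
    intro k
    rw [← Fintype.card_eq, Fintype.card_subtype, Fintype.card_subtype]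
    have := congrArg (Multiset.count k) h
    rw [Multiset.count_map, Multiset.count_map, ← Finset.filter_val, ← Finset.filter_val] at this
    simpa only [Finset.card_def, eq_comm] using this
  exact ⟨Equiv.ofFiberEquiv fun k => (hc k).some, Equiv.ofFiberEquiv_map _⟩

/-- Match the fibres of `d` and `b` of equal sizes, then choose bijections between matched fibres.
-/
theorem exists_perm_of_fiberCards_eq {n : ℕ} {α β : Type*} [DecidableEq α] [DecidableEq β]
    (d : Fin n → α) (b : Fin n → β) (h : fiberCards d = fiberCards b) :
    ∃ σ : Equiv.Perm (Fin n), ∀ i j, d (σ i) = d (σ j) ↔ b i = b j := by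
  have h' : (Finset.univ : Finset (Finset.univ.image b)).val.map
        (fun a : Finset.univ.image b => (Finset.univ.filter fun i => b i = a.1).card) =
      (Finset.univ : Finset (Finset.univ.image d)).val.map
        (fun a : Finset.univ.image d => (Finset.univ.filter fun i => d i = a.1).card) :=
    (Multiset.attach_map_val' _ _).trans (h.symm.trans (Multiset.attach_map_val' _ _).symm)
  obtain ⟨e, he⟩ := exists_equiv_of_map_eq _ _ h'
  have hc : ∀ a : Finset.univ.image d, Nonempty
      ({i // e ⟨b i, Finset.mem_image_of_mem b (Finset.mem_univ i)⟩ = a} ≃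
        {i // (⟨d i, Finset.mem_image_of_mem d (Finset.mem_univ i)⟩ : Finset.univ.image d) = a}) := by
    intro a
    obtain ⟨c, rfl⟩ := e.surjective a
    rw [← Fintype.card_eq, Fintype.card_subtype, Fintype.card_subtype]
    simpa only [EmbeddingLike.apply_eq_iff_eq, Subtype.ext_iff] using (he c).symm
  refine ⟨Equiv.ofFiberEquiv fun a => (hc a).some, fun i j => ?_⟩
  have h1 := fun i => Equiv.ofFiberEquiv_map (fun a => (hc a).some) i
  have h2 : ∀ i, d (Equiv.ofFiberEquiv (fun a => (hc a).some) i) =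
      (e ⟨b i, Finset.mem_image_of_mem b (Finset.mem_univ i)⟩).1 := fun i =>
    congrArg Subtype.val (h1 i)
  rw [h2, h2, ← Subtype.ext_iff, e.apply_eq_iff_eq, Subtype.ext_iff]

/-- Idempotence makes `b i` a distinguished element of the block of `i`. These representatives later
index one eigenvalue per block and the one dependent diagonal entry of a traceless block. -/
theorem exists_idempotent_fiberCards {n : ℕ} (μ : n.Partition) :
    ∃ b : Fin n → Fin n, (∀ i, b (b i) = b i) ∧ fiberCards b = μ.parts := by
  set l := μ.parts.toList with hl
  have hsum : ∑ i : Fin l.length, l.get i = n := by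
    rw [← List.sum_ofFn, List.ofFn_get]
    conv_rhs => rw [← μ.parts_sum, ← Multiset.coe_toList μ.parts]
    rfl
  let E : (Σ i : Fin l.length, Fin (l.get i)) ≃ Fin n :=
    finSigmaFinEquiv.trans (finCongr hsum)
  let d : Fin n → Fin l.length := fun i => (E.symm i).1
  have hcard : ∀ a, (Finset.univ.filter fun i => d i = a).card = l.get a := by
    intro a
    rw [← Fintype.card_subtype]
    have e1 : {i // d i = a} ≃ {x : Σ i : Fin l.length, Fin (l.get i) // x.1 = a} :=
      E.symm.subtypeEquiv fun i => Iff.rfl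
    rw [Fintype.card_congr (e1.trans (Equiv.sigmaSubtype a)), Fintype.card_fin]
  have hsurj : Function.Surjective d := by
    intro a
    have hpos : 0 < l.get a := μ.parts_pos (by
      rw [← Multiset.mem_toList]; exact List.get_mem _ _)
    rw [← hcard a, Finset.card_pos] at hpos
    obtain ⟨i, hi⟩ := hpos
    exact ⟨i, (Finset.mem_filter.1 hi).2⟩
  -- `d` sends an index to its block, and the section picks a representative in each block.
  refine ⟨Function.surjInv hsurj ∘ d, fun i => ?_, ?_⟩
  · simp [Function.surjInv_eq hsurj]
  · rw [fiberCards_comp_of_injOn _ _ (Function.injective_surjInv hsurj).injOn, fiberCards,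
      Finset.image_univ_of_surjective hsurj]
    simp only [hcard]
    rw [← Multiset.coe_toList μ.parts, ← hl, Fin.univ_val_map]
    simp

end

/-! ### Strata, block families and irreducibility -/

section

open MvPolynomial Matrix

/-- The affine polynomial with values `a` at `0` and `b` at `1`. -/
def Polynomial.line (a b : ℂ) : Polynomial ℂ :=
  Polynomial.C a + Polynomial.X * Polynomial.C (b - a)

@[simp] theorem Polynomial.eval_line (a b s : ℂ) :
    (Polynomial.line a b).eval s = a + s * (b - a) := by
  simp [Polynomial.line]

namespace Matrix

variable {n : ℕ}

/-- The affine matrix of polynomials with values `A` at `0` and `B` at `1`. -/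
def line (A B : Matrix (Fin n) (Fin n) ℂ) :
    Matrix (Fin n) (Fin n) (Polynomial ℂ) :=
  of fun i j => Polynomial.line (A i j) (B i j)

theorem evalAt_apply (A : Matrix (Fin n) (Fin n) (Polynomial ℂ)) (s : ℂ) (i j : Fin n) :
    A.evalAt s i j = (A i j).eval s := by
  rw [evalAt, map_apply, Polynomial.coe_aeval_eq_eval]

@[simp] theorem evalAt_line (A B : Matrix (Fin n) (Fin n) ℂ) (s : ℂ) :
    (line A B).evalAt s = A + s • (B - A) := by
  ext i j
  rw [evalAt_apply]
  simp [line]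

theorem evalAt_mul (A B : Matrix (Fin n) (Fin n) (Polynomial ℂ)) (s : ℂ) :
    (A * B).evalAt s = A.evalAt s * B.evalAt s :=
  Matrix.map_mul (f := (Polynomial.aeval s : Polynomial ℂ →ₐ[ℂ] ℂ).toRingHom)

theorem evalAt_sub (A B : Matrix (Fin n) (Fin n) (Polynomial ℂ)) (s : ℂ) :
    (A - B).evalAt s = A.evalAt s - B.evalAt s := by
  ext i j; simp

theorem evalAt_diagonal (d : Fin n → Polynomial ℂ) (s : ℂ) :
    (diagonal d).evalAt s = diagonal fun i => (d i).eval s := by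
  ext i j
  rw [evalAt_apply]
  by_cases h : i = j
  · subst h; simp
  · simp [diagonal_apply_ne _ h]

theorem evalAt_map_C (A : Matrix (Fin n) (Fin n) ℂ) (s : ℂ) :
    (A.map Polynomial.C).evalAt s = A := by
  ext i j; simp

theorem conj_mul_conj {g : Matrix (Fin n) (Fin n) ℂ} (hg : g.det ≠ 0)
    (A B : Matrix (Fin n) (Fin n) ℂ) : (g * A * g⁻¹) * (g * B * g⁻¹) = g * (A * B) * g⁻¹ := by
  have := nonsing_inv_mul g (isUnit_iff_ne_zero.2 hg)
  calc (g * A * g⁻¹) * (g * B * g⁻¹) = g * A * (g⁻¹ * g) * B * g⁻¹ := by simp only [mul_assoc]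
    _ = _ := by rw [this, mul_one, mul_assoc g A B]

theorem conj_inv_conj {g : Matrix (Fin n) (Fin n) ℂ} (hg : g.det ≠ 0)
    (A : Matrix (Fin n) (Fin n) ℂ) : g * (g⁻¹ * A * g) * g⁻¹ = A := by
  have := mul_nonsing_inv g (isUnit_iff_ne_zero.2 hg)
  calc g * (g⁻¹ * A * g) * g⁻¹ = (g * g⁻¹) * A * (g * g⁻¹) := by simp only [mul_assoc]
    _ = A := by rw [this, mul_one, one_mul]

theorem inv_conj_conj {g : Matrix (Fin n) (Fin n) ℂ} (hg : g.det ≠ 0)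
    (A : Matrix (Fin n) (Fin n) ℂ) : g⁻¹ * (g * A * g⁻¹) * g = A := by
  have := nonsing_inv_mul g (isUnit_iff_ne_zero.2 hg)
  calc g⁻¹ * (g * A * g⁻¹) * g = (g⁻¹ * g) * A * (g⁻¹ * g) := by simp only [mul_assoc]
    _ = A := by rw [this, mul_one, one_mul]

theorem lie_conj {g : Matrix (Fin n) (Fin n) ℂ} (hg : g.det ≠ 0)
    (A B : Matrix (Fin n) (Fin n) ℂ) : ⁅g * A * g⁻¹, g * B * g⁻¹⁆ = g * ⁅A, B⁆ * g⁻¹ := by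
  rw [Ring.lie_def, Ring.lie_def, conj_mul_conj hg, conj_mul_conj hg, mul_sub, sub_mul]

theorem lie_diagonal_apply (d : Fin n → ℂ) (A : Matrix (Fin n) (Fin n) ℂ) (i j : Fin n) :
    ⁅diagonal d, A⁆ i j = (d i - d j) * A i j := by
  rw [Ring.lie_def, sub_apply, diagonal_mul, mul_diagonal]
  ring

theorem lie_eq_zero_iff {A B : Matrix (Fin n) (Fin n) ℂ} : ⁅A, B⁆ = 0 ↔ A * B = B * A := by
  rw [Ring.lie_def, sub_eq_zero]

theorem charpoly_conj {g : Matrix (Fin n) (Fin n) ℂ} (hg : g.det ≠ 0)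
    (A : Matrix (Fin n) (Fin n) ℂ) : (g * A * g⁻¹).charpoly = A.charpoly := by
  have h : IsUnit g := (isUnit_iff_isUnit_det g).2 (isUnit_iff_ne_zero.2 hg)
  obtain ⟨u, rfl⟩ := h
  exact charpoly_units_conj u A

theorem roots_charpoly_conj_diagonal {g : Matrix (Fin n) (Fin n) ℂ} (hg : g.det ≠ 0)
    (d : Fin n → ℂ) : (g * diagonal d * g⁻¹).charpoly.roots = Finset.univ.val.map d := by
  rw [charpoly_conj hg, charpoly_diagonal]
  exact Polynomial.roots_multiset_prod_X_sub_C (Finset.univ.val.map d) ▸ by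
    rw [Multiset.map_map]; rfl

theorem fiberCards_eq_of_conj {g h : Matrix (Fin n) (Fin n) ℂ} (hg : g.det ≠ 0) (hh : h.det ≠ 0)
    {d e : Fin n → ℂ} (H : g * diagonal d * g⁻¹ = h * diagonal e * h⁻¹) :
    fiberCards d = fiberCards e := by
  rw [fiberCards_eq_dedup, fiberCards_eq_dedup, ← roots_charpoly_conj_diagonal hg, H,
    roots_charpoly_conj_diagonal hh]

theorem conj_submatrix {g : Matrix (Fin n) (Fin n) ℂ} (σ : Equiv.Perm (Fin n))
    (A : Matrix (Fin n) (Fin n) ℂ) :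
    g.submatrix id σ * A.submatrix σ σ * (g.submatrix id σ)⁻¹ = g * A * g⁻¹ := by
  have h : (g.submatrix id σ)⁻¹ = g⁻¹.submatrix σ id := inv_submatrix_equiv g (Equiv.refl _) σ
  rw [h, submatrix_mul_equiv, submatrix_mul_equiv, submatrix_id_id]

theorem det_submatrix_ne_zero {g : Matrix (Fin n) (Fin n) ℂ} (hg : g.det ≠ 0)
    (σ : Equiv.Perm (Fin n)) : (g.submatrix id σ).det ≠ 0 := by
  rw [det_permute']
  exact mul_ne_zero (by simp) hg

end Matrix

namespace CotGl

variable {n : ℕ}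

/-- The points of the stratum of type `μ`, as a subset of `T^* gl_n`. -/
def stratum (μ : n.Partition) : Set (CotGl n) :=
  {p | p ∈ Lambda n ∧ IsDiagonalizableOfType μ p.base}

theorem image_lambdaStratum (μ : n.Partition) :
    Subtype.val '' LambdaStratum μ = stratum μ := by
  ext p
  constructor
  · rintro ⟨q, hq, rfl⟩; exact ⟨q.2, hq⟩
  · exact fun ⟨h1, h2⟩ => ⟨⟨p, h1⟩, h2, rfl⟩

theorem isDiagonalizableOfType_iff {μ : n.Partition} {x : Matrix (Fin n) (Fin n) ℂ} :
    IsDiagonalizableOfType μ x ↔ ∃ (g : Matrix (Fin n) (Fin n) ℂ) (d : Fin n → ℂ),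
      g.det ≠ 0 ∧ x = g * diagonal d * g⁻¹ ∧ fiberCards d = μ.parts := by
  constructor
  · rintro ⟨g, d, hx, hd⟩
    exact ⟨g, d, g.det_ne_zero, by rw [hx, coe_units_inv], hd⟩
  · rintro ⟨g, d, hg, hx, hd⟩
    exact ⟨GeneralLinearGroup.mkOfDetNeZero g hg, d, by rw [coe_units_inv]; exact hx, hd⟩

/-- The block matrices with respect to `b`. -/
def IsBlock (b : Fin n → Fin n) (T : Matrix (Fin n) (Fin n) ℂ) : Prop :=
  ∀ i j, b i ≠ b j → T i j = 0

/-- The block matrices with respect to `b` with zero diagonal. -/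
def IsHollow (b : Fin n → Fin n) (T : Matrix (Fin n) (Fin n) ℂ) : Prop :=
  ∀ i j, i = j ∨ b i ≠ b j → T i j = 0

theorem IsHollow.isBlock {b : Fin n → Fin n} {T : Matrix (Fin n) (Fin n) ℂ} (hT : IsHollow b T) :
    IsBlock b T := fun i j h => hT i j (Or.inr h)

/-- The conjugates of the pairs of a diagonal matrix whose eigenspaces are the blocks of `b`, and
a block matrix with zero diagonal. -/
def blockFamily (b : Fin n → Fin n) : Set (CotGl n) :=
  {p | ∃ (g : Matrix (Fin n) (Fin n) ℂ) (d : Fin n → ℂ) (T : Matrix (Fin n) (Fin n) ℂ),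
    g.det ≠ 0 ∧ (∀ i j, d i = d j ↔ b i = b j) ∧ IsHollow b T ∧
    p = mk (g * diagonal d * g⁻¹) (g * T * g⁻¹)}

/-- The pairs in `blockFamily b` for which no off-diagonal entry inside a block vanishes. -/
def genericBlockFamily (b : Fin n → Fin n) : Set (CotGl n) :=
  {p | ∃ (g : Matrix (Fin n) (Fin n) ℂ) (d : Fin n → ℂ) (T : Matrix (Fin n) (Fin n) ℂ),
    g.det ≠ 0 ∧ (∀ i j, d i = d j ↔ b i = b j) ∧ IsHollow b T ∧
    (∀ i j, i ≠ j → b i = b j → T i j ≠ 0) ∧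
    p = mk (g * diagonal d * g⁻¹) (g * T * g⁻¹)}

theorem genericBlockFamily_subset (b : Fin n → Fin n) : genericBlockFamily b ⊆ blockFamily b :=
  fun _ ⟨g, d, T, hg, hd, hT, _, hp⟩ => ⟨g, d, T, hg, hd, hT, hp⟩

/-- A hollow T is the commutator of diag(0, …, n - 1) with the matrix of entries T i j / (i - j),
and both factors commute with D because T respects the blocks. -/
theorem blockFamily_subset_stratum {b : Fin n → Fin n} (hb : ∀ i, b (b i) = b i)
    {μ : n.Partition} (hμ : fiberCards b = μ.parts) : blockFamily b ⊆ stratum μ := by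
  rintro _ ⟨g, d, T, hg, hd, hT, rfl⟩
  refine ⟨?_, isDiagonalizableOfType_iff.2 ⟨g, d, hg, rfl, ?_⟩⟩
  · have hij : ∀ i j : Fin n, i ≠ j → ((i : ℕ) : ℂ) - ((j : ℕ) : ℂ) ≠ 0 := by
      intro i j hij h
      rw [sub_eq_zero] at h
      exact hij (Fin.ext (by exact_mod_cast h))
    refine ⟨g * diagonal (fun i : Fin n => ((i : ℕ) : ℂ)) * g⁻¹,
      g * (of fun i j => T i j / (((i : ℕ) : ℂ) - ((j : ℕ) : ℂ))) * g⁻¹, ?_, ?_, ?_⟩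
    · rw [base_mk, lie_conj hg]
      have : ⁅diagonal d, diagonal fun i : Fin n => ((i : ℕ) : ℂ)⁆ = 0 := by
        ext i j
        rw [lie_diagonal_apply]
        by_cases h : i = j
        · simp [h]
        · simp [diagonal_apply_ne _ h]
      rw [this, mul_zero, zero_mul]
    · rw [base_mk, lie_conj hg]
      have : ⁅diagonal d, of fun i j => T i j / (((i : ℕ) : ℂ) - ((j : ℕ) : ℂ))⁆ = 0 := by
        ext i j
        rw [lie_diagonal_apply]
        by_cases h : b i = b j
        · simp [(hd i j).2 h]
        · simp [hT i j (Or.inr h)]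
      rw [this, mul_zero, zero_mul]
    · rw [fib_mk, lie_conj hg]
      congr 2
      ext i j
      rw [lie_diagonal_apply, of_apply]
      by_cases h : i = j
      · rw [hT i j (Or.inl h), h, sub_self, zero_mul]
      · rw [mul_div_cancel₀ _ (hij i j h)]
  · rw [← hμ]
    have : d = d ∘ b := funext fun i => (hd _ _).2 (hb i).symm
    rw [this]
    apply fiberCards_comp_of_injOn
    rintro _ ⟨i, rfl⟩ _ ⟨j, rfl⟩ h
    have := (hd _ _).1 h
    rwa [hb, hb] at this

/-- In an eigenbasis of `y`, whose eigenvalues are distinct, `x` is diagonal because it commutes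
with `y`. The commutator of the diagonal `y` with `z` has zero diagonal, and it is a block matrix
since `z` commutes with `x`. A permutation of the basis turns the eigenspaces of `x` into the blocks
of `b`. -/
theorem mk_lie_mem_blockFamily {b : Fin n → Fin n} {x y z : Matrix (Fin n) (Fin n) ℂ}
    (hy : ⁅x, y⁆ = 0) (hz : ⁅x, z⁆ = 0) (hsep : y.charpoly.Separable)
    {g : Matrix (Fin n) (Fin n) ℂ} {d : Fin n → ℂ} (hg : g.det ≠ 0)
    (hx : x = g * diagonal d * g⁻¹) (hd : fiberCards d = fiberCards b) :
    mk x ⁅y, z⁆ ∈ blockFamily b := by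
  obtain ⟨h, e, hh, hye⟩ := exists_eq_conj_diagonal_of_squarefree y hsep.squarefree
    (aeval_self_charpoly y)
  have he : Function.Injective e := by
    have h1 := Polynomial.nodup_roots hsep
    rw [hye, roots_charpoly_conj_diagonal hh] at h1
    exact Multiset.inj_on_of_nodup_map h1 |> fun H i j hij =>
      H i (Finset.mem_univ i) j (Finset.mem_univ j) hij
  have conj0 : ∀ A B : Matrix (Fin n) (Fin n) ℂ, ⁅A, B⁆ = 0 →
      ⁅h⁻¹ * A * h, h⁻¹ * B * h⁆ = 0 := by
    intro A B hAB
    rw [← inv_conj_conj hh ⁅h⁻¹ * A * h, h⁻¹ * B * h⁆, ← lie_conj hh, conj_inv_conj hh,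
      conj_inv_conj hh, hAB, mul_zero, zero_mul]
  have hD : ∃ d', h⁻¹ * x * h = diagonal d' := by
    refine ⟨fun i => (h⁻¹ * x * h) i i, ?_⟩
    have h1 := conj0 y x (lie_eq_zero_iff.2 (lie_eq_zero_iff.1 hy).symm)
    rw [hye, inv_conj_conj hh] at h1
    ext i j
    by_cases hij : i = j
    · simp [hij]
    · rw [diagonal_apply_ne _ hij]
      have := congrFun (congrFun h1 i) j
      rw [lie_diagonal_apply] at this
      exact (mul_eq_zero.1 this).resolve_left (sub_ne_zero.2 (he.ne hij))
  obtain ⟨d', hd'⟩ := hD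
  have hx' : x = h * diagonal d' * h⁻¹ := by rw [← hd', conj_inv_conj hh]
  obtain ⟨σ, hσ⟩ := exists_perm_of_fiberCards_eq d' b
    ((fiberCards_eq_of_conj hh hg (hx' ▸ hx)).trans hd)
  refine ⟨h.submatrix id σ, d' ∘ σ, ⁅diagonal e, h⁻¹ * z * h⁆.submatrix σ σ,
    det_submatrix_ne_zero hh σ, hσ, ?_, ?_⟩
  · rintro i j (hij | hij)
    · rw [submatrix_apply, lie_diagonal_apply, hij, sub_self, zero_mul]
    · rw [submatrix_apply, lie_diagonal_apply]
      have h1 := conj0 x z hz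
      rw [hd'] at h1
      have := congrFun (congrFun h1 (σ i)) (σ j)
      rw [lie_diagonal_apply] at this
      rw [(mul_eq_zero.1 this).resolve_left (sub_ne_zero.2 fun H => hij ((hσ i j).1 H)), mul_zero]
  · have : diagonal (d' ∘ σ) = (diagonal d').submatrix σ σ :=
      (submatrix_diagonal d' σ σ.injective).symm
    rw [this, conj_submatrix, conj_submatrix, ← hx', ← lie_conj hh, ← hye, conj_inv_conj hh]

/-- The line from `y` to a matrix `y₀` that commutes with x and has distinct eigenvalues stays in
the centralizer. Almost all its points have distinct eigenvalues, so the commutators with `z`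
approach [y, z] inside the block family. -/
theorem stratum_subset_closure_blockFamily {b : Fin n → Fin n}
    {μ : n.Partition} (hμ : fiberCards b = μ.parts) : stratum μ ⊆ closure (blockFamily b) := by
  rintro p ⟨⟨y, z, hy, hz, hp⟩, hdiag⟩
  obtain ⟨g, d, hg, hx, hd⟩ := isDiagonalizableOfType_iff.1 hdiag
  rw [← hμ] at hd
  rw [mem_closure_iff]
  intro f hf
  set y₀ := g * diagonal (fun i : Fin n => ((i : ℕ) : ℂ)) * g⁻¹ with hy₀
  have hxy₀ : ⁅p.base, y₀⁆ = 0 := by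
    rw [hx, hy₀, lie_conj hg]
    have : ⁅diagonal d, diagonal fun i : Fin n => ((i : ℕ) : ℂ)⁆ = 0 := by
      ext i j
      rw [lie_diagonal_apply]
      by_cases h : i = j
      · simp [h]
      · simp [diagonal_apply_ne _ h]
    rw [this, mul_zero, zero_mul]
  have hsep : y₀.charpoly.Separable := by
    rw [hy₀, charpoly_conj hg, charpoly_diagonal, Polynomial.separable_prod_X_sub_C_iff]
    intro i j hij
    exact Fin.ext (Nat.cast_injective hij)
  set Y := line y y₀ with hY
  have hev : ∀ᶠ s in Filter.cofinite, (Y.evalAt s).charpoly.Separable :=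
    eventually_squarefree_charpoly Y (s₀ := 1) (by rw [hY, evalAt_line]; simpa using hsep)
  have key := eval_eq_zero_of_eventually (x := p.base.map Polynomial.C)
    (t := Y * z.map Polynomial.C - z.map Polynomial.C * Y) (f := f) (by
      filter_upwards [hev] with s hs
      rw [evalAt_map_C, evalAt_sub, evalAt_mul, evalAt_mul, evalAt_map_C, ← Ring.lie_def]
      apply mem_ideal.1 hf
      refine mk_lie_mem_blockFamily ?_ hz hs hg hx hd
      rw [lie_eq_zero_iff] at hy hxy₀ ⊢
      rw [hY, evalAt_line, mul_add, add_mul, mul_smul_comm, smul_mul_assoc, mul_sub, sub_mul, hy,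
        hxy₀]) 0
  rw [evalAt_map_C, evalAt_sub, evalAt_mul, evalAt_mul, evalAt_map_C, ← Ring.lie_def, hY,
    evalAt_line, zero_smul, add_zero, ← hp, mk_base_fib] at key
  exact key

theorem blockFamily_subset_closure (b : Fin n → Fin n) :
    blockFamily b ⊆ closure (genericBlockFamily b) := by
  rintro _ ⟨g, d, T, hg, hd, hT, rfl⟩
  rw [mem_closure_iff]
  intro f hf
  -- Along the line from `T` to `J`, each off-diagonal entry inside a block is `T i j + s`, which
  -- vanishes for only one `s`.
  set J : Matrix (Fin n) (Fin n) ℂ := of fun i j => if i ≠ j ∧ b i = b j then T i j + 1 else 0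
    with hJ
  have key := eval_eq_zero_of_eventually
    (x := (g * diagonal d * g⁻¹).map Polynomial.C)
    (t := g.map Polynomial.C * line T J * g⁻¹.map Polynomial.C) (f := f) (by
      have hne : ∀ᶠ s in Filter.cofinite, ∀ i j, i ≠ j → b i = b j →
          (T + (s : ℂ) • (J - T)) i j ≠ 0 := by
        simp only [Filter.eventually_all]
        intro i j hij hbij
        have h0 : Polynomial.line (T i j) (T i j + 1) ≠ 0 := by
          intro h0
          have h1 := congrArg (Polynomial.eval 0) h0
          have h2 := congrArg (Polynomial.eval 1) h0
          simp only [Polynomial.eval_line, Polynomial.eval_zero] at h1 h2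
          have : (1 : ℂ) = 0 := by linear_combination h2 - h1
          exact one_ne_zero this
        filter_upwards [Polynomial.eventually_eval_ne_zero h0] with s hs
        rw [Polynomial.eval_line] at hs
        simpa [hJ, hij, hbij] using hs
      filter_upwards [hne] with s hs
      rw [evalAt_map_C, evalAt_mul, evalAt_mul, evalAt_map_C, evalAt_map_C, evalAt_line]
      refine mem_ideal.1 hf _ ⟨g, d, _, hg, hd, fun i j hij => ?_, hs, rfl⟩
      have hJ0 : J i j = 0 := by
        rw [hJ, of_apply, if_neg]
        tauto
      simp [hT i j hij, hJ0]) 0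
  rw [evalAt_map_C, evalAt_mul, evalAt_mul, evalAt_map_C, evalAt_map_C, evalAt_line, zero_smul,
    add_zero] at key
  exact key

theorem ideal_genericBlockFamily {b : Fin n → Fin n} (hb : ∀ i, b (b i) = b i)
    {μ : n.Partition} (hμ : fiberCards b = μ.parts) :
    ideal (genericBlockFamily b) = ideal (stratum μ) := by
  rw [← ideal_eq_of_subset_closure (genericBlockFamily_subset b) (blockFamily_subset_closure b),
    ← ideal_eq_of_subset_closure (blockFamily_subset_stratum hb hμ)
      (stratum_subset_closure_blockFamily hμ)]

theorem genericBlockFamily_nonempty (b : Fin n → Fin n) : (genericBlockFamily b).Nonempty := by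
  refine ⟨_, 1, fun i => ((b i : ℕ) : ℂ), of fun i j => if i ≠ j ∧ b i = b j then 1 else 0, by simp,
    fun i j => ?_, fun i j hij => ?_, fun i j hij hb => by simp [hij, hb], rfl⟩
  · exact ⟨fun h => Fin.ext (Nat.cast_injective h), fun h => by simp [h]⟩
  · rw [of_apply, if_neg]
    tauto

/-- Join the parameters (g, d, T) of a point where `f₁` is nonzero to those of a point where `f₂` is
nonzero by a line. Almost all of it lies in the family, so the product of the two numerators is the
zero polynomial; one of them is then zero, which contradicts its value at 0 or at 1. -/
theorem isPrime_ideal_genericBlockFamily (b : Fin n → Fin n) :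
    (ideal (genericBlockFamily b)).IsPrime := by
  refine ⟨fun h => ?_, fun {f₁ f₂} hf => ?_⟩
  · obtain ⟨p, hp⟩ := genericBlockFamily_nonempty b
    have : (1 : MvPolynomial (Idx n) ℂ) ∈ ideal (genericBlockFamily b) := h ▸ Submodule.mem_top
    simpa using mem_ideal.1 this p hp
  by_contra! hc
  simp only [mem_ideal, not_forall] at hc
  obtain ⟨⟨_, ⟨g, d, T, hg, hd, hT, hT', rfl⟩, h₁⟩, ⟨_, ⟨g', d', T', hg', hd', hT₂, -, rfl⟩, h₂⟩⟩ := hc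
  set G := line g g' with hG
  set δ : Fin n → Polynomial ℂ := fun i => Polynomial.line (d i) (d' i) with hδ
  set Θ := line T T' with hΘ
  have hdet : G.det ≠ 0 := by
    intro h0
    have := det_evalAt G 0
    rw [h0, Polynomial.eval_zero, hG, evalAt_line, zero_smul, add_zero] at this
    exact hg this
  have hne₁ : ∀ᶠ s in Filter.cofinite, (G.evalAt s).det ≠ 0 := by
    filter_upwards [Polynomial.eventually_eval_ne_zero hdet] with s hs
    rwa [det_evalAt]
  have hne₂ : ∀ᶠ s in Filter.cofinite, ∀ i j, (δ i).eval s = (δ j).eval s ↔ b i = b j := by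
    simp only [Filter.eventually_all]
    intro i j
    by_cases hbij : b i = b j
    · refine Filter.Eventually.of_forall fun s => ?_
      simp [hδ, (hd i j).2 hbij, (hd' i j).2 hbij, hbij]
    · have h0 : δ i - δ j ≠ 0 := by
        intro h0
        have := congrArg (Polynomial.eval 0) h0
        simp only [hδ, Polynomial.eval_sub, Polynomial.eval_line, zero_mul, add_zero,
          Polynomial.eval_zero, sub_eq_zero] at this
        exact hbij ((hd i j).1 this)
      filter_upwards [Polynomial.eventually_eval_ne_zero h0] with s hs
      rw [Polynomial.eval_sub, sub_ne_zero] at hs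
      exact ⟨fun h => absurd h hs, fun h => absurd h hbij⟩
  have hne₃ : ∀ᶠ s in Filter.cofinite, ∀ i j, i ≠ j → b i = b j → (Θ.evalAt s) i j ≠ 0 := by
    simp only [Filter.eventually_all]
    intro i j hij hbij
    have h0 : Polynomial.line (T i j) (T' i j) ≠ 0 := by
      intro h0
      have := congrArg (Polynomial.eval 0) h0
      simp only [Polynomial.eval_line, zero_mul, add_zero, Polynomial.eval_zero] at this
      exact hT' i j hij hbij this
    filter_upwards [Polynomial.eventually_eval_ne_zero h0] with s hs
    rw [evalAt_apply]
    exact hs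
  obtain ⟨N₁, k₁, hN₁⟩ := exists_numerator_evalAt G (diagonal δ) Θ f₁
  obtain ⟨N₂, k₂, hN₂⟩ := exists_numerator_evalAt G (diagonal δ) Θ f₂
  have hN : N₁ * N₂ = 0 := by
    apply Polynomial.eq_zero_of_eventually
    filter_upwards [hne₁, hne₂, hne₃] with s hs₁ hs₂ hs₃
    have e₁ := hN₁ s hs₁
    have e₂ := hN₂ s hs₁
    rw [evalAt_diagonal] at e₁ e₂
    have hmem : mk (G.evalAt s * (diagonal fun i => (δ i).eval s) * (G.evalAt s)⁻¹)
        (G.evalAt s * Θ.evalAt s * (G.evalAt s)⁻¹) ∈ genericBlockFamily b :=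
      ⟨_, _, _, hs₁, hs₂, fun i j hij => by
        rw [hΘ, evalAt_line]; simp [hT i j hij, hT₂ i j hij], hs₃, rfl⟩
    have := mem_ideal.1 hf _ hmem
    rw [map_mul] at this
    rw [Polynomial.eval_mul, e₁, e₂, mul_mul_mul_comm, this, mul_zero]
  rcases mul_eq_zero.1 hN with h0 | h0
  · have hG0 : G.evalAt 0 = g := by rw [hG, evalAt_line, zero_smul, add_zero]
    have e := hN₁ 0 (by rw [hG0]; exact hg)
    rw [h0, Polynomial.eval_zero, evalAt_diagonal, hG0, hΘ, evalAt_line, zero_smul,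
      add_zero] at e
    simp only [hδ, Polynomial.eval_line, zero_mul, add_zero] at e
    exact h₁ ((mul_eq_zero.1 e.symm).resolve_left (pow_ne_zero _ hg))
  · have hG0 : G.evalAt 1 = g' := by rw [hG, evalAt_line, one_smul, add_sub_cancel]
    have e := hN₂ 1 (by rw [hG0]; exact hg')
    rw [h0, Polynomial.eval_zero, evalAt_diagonal, hG0, hΘ, evalAt_line, one_smul,
      add_sub_cancel] at e
    simp only [hδ, Polynomial.eval_line, one_mul, add_sub_cancel] at e
    exact h₂ ((mul_eq_zero.1 e.symm).resolve_left (pow_ne_zero _ hg'))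

end CotGl

end

/-! ### Isotropic spaces of tangent vectors -/

section

open MvPolynomial Matrix

namespace CotGl

variable {n : ℕ}

/-- The second-order terms are needed for conjugation by 1 + sE with E² = 0, which is quadratic in
s. -/
theorem mem_tangentSpace_of_quadratic {Z : Set (CotGl n)} {q : CotGl n}
    (A₁ A₂ B₁ B₂ : Matrix (Fin n) (Fin n) ℂ)
    (h : ∀ᶠ s : ℂ in Filter.cofinite,
      mk (q.base + s • A₁ + s ^ 2 • A₂) (q.fib + s • B₁ + s ^ 2 • B₂) ∈ closure Z) :
    mk A₁ B₁ ∈ tangentSpace Z q := by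
  let quad : Matrix (Fin n) (Fin n) ℂ → Matrix (Fin n) (Fin n) ℂ → Matrix (Fin n) (Fin n) ℂ →
      Matrix (Fin n) (Fin n) (Polynomial ℂ) := fun P Q R => of fun i j =>
    Polynomial.C (P i j) + Polynomial.X * Polynomial.C (Q i j) +
      Polynomial.X ^ 2 * Polynomial.C (R i j)
  have hquad : ∀ P Q R s, (quad P Q R).evalAt s = P + s • Q + s ^ 2 • R := by
    intro P Q R s
    ext i j
    rw [evalAt_apply]
    simp only [quad, of_apply, Polynomial.eval_add, Polynomial.eval_mul, Polynomial.eval_C,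
      Polynomial.eval_X, Polynomial.eval_pow, Matrix.add_apply, Matrix.smul_apply, smul_eq_mul]
  refine mem_tangentSpace_of_curve (quad q.base A₁ A₂) (quad q.fib B₁ B₂) ?_ ?_ ?_ ?_ ?_
  · simpa only [hquad] using h
  all_goals
    ext i j
    simp [quad]

theorem tangentSpace_congr {Z Z' : Set (CotGl n)} (h : ideal Z = ideal Z') (q : CotGl n) :
    tangentSpace Z q = tangentSpace Z' q := by
  ext v
  rw [mem_tangentSpace, mem_tangentSpace, h]

theorem symplecticForm_conj {g : Matrix (Fin n) (Fin n) ℂ} (hg : g.det ≠ 0)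
    (A B A' B' : Matrix (Fin n) (Fin n) ℂ) :
    symplecticForm (mk (g * A * g⁻¹) (g * B * g⁻¹)) (mk (g * A' * g⁻¹) (g * B' * g⁻¹)) =
      (A * B').trace - (A' * B).trace := by
  have h : ∀ P : Matrix (Fin n) (Fin n) ℂ, (g * P * g⁻¹).trace = P.trace := fun P => by
    rw [trace_mul_comm, ← mul_assoc, nonsing_inv_mul g (isUnit_iff_ne_zero.2 hg), one_mul]
  simp only [symplecticForm, base_mk, fib_mk, conj_mul_conj hg, h]

theorem _root_.Matrix.add_lie_apply (u v D : Matrix (Fin n) (Fin n) ℂ) :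
    ⁅u + v, D⁆ = ⁅u, D⁆ + ⁅v, D⁆ := by
  simp only [Ring.lie_def, add_mul, mul_add]
  abel

/-- By invariance of the trace and the Jacobi identity, the two sides differ by tr(u [u', [D, T]]).
-/
theorem trace_lie_mul_lie_comm {D T : Matrix (Fin n) (Fin n) ℂ} (h : D * T = T * D)
    (u u' : Matrix (Fin n) (Fin n) ℂ) :
    (⁅u, D⁆ * ⁅u', T⁆).trace = (⁅u', D⁆ * ⁅u, T⁆).trace := by
  have e₁ : (u * D * (u' * T)).trace = (D * u' * (T * u)).trace := by
    rw [mul_assoc, trace_mul_comm]; simp only [mul_assoc]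
  have e₂ : (D * u * (T * u')).trace = (u' * D * (u * T)).trace := by
    rw [← mul_assoc, trace_mul_comm]; simp only [mul_assoc]
  have e₃ : (u * D * (T * u')).trace = (D * u' * (u * T)).trace := by
    rw [trace_mul_comm, trace_mul_comm (D * u')]
    calc (T * u' * (u * D)).trace = (T * (u' * u * D)).trace := by simp only [mul_assoc]
      _ = (u' * u * D * T).trace := trace_mul_comm _ _
      _ = (u' * (u * T * D)).trace := by rw [mul_assoc _ D, h]; simp only [mul_assoc]
      _ = (u * T * (D * u')).trace := by rw [trace_mul_comm]; simp only [mul_assoc]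
  have e₄ : (D * u * (u' * T)).trace = (u' * D * (T * u)).trace := by
    calc (D * u * (u' * T)).trace = (D * (u * (u' * T))).trace := by simp only [mul_assoc]
      _ = (u * (u' * T) * D).trace := trace_mul_comm _ _
      _ = (u * (u' * (T * D))).trace := by simp only [mul_assoc]
      _ = (u' * (D * T) * u).trace := by rw [← h, trace_mul_comm]
      _ = (u' * D * (T * u)).trace := by simp only [mul_assoc]
  simp only [Ring.lie_def, sub_mul, mul_sub, trace_sub]
  rw [e₁, e₂, e₃, e₄]
  ring

theorem trace_lie_mul_of_commute {D τ : Matrix (Fin n) (Fin n) ℂ} (h : D * τ = τ * D)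
    (u : Matrix (Fin n) (Fin n) ℂ) : (⁅u, D⁆ * τ).trace = 0 := by
  have : (D * u * τ).trace = (u * D * τ).trace := by
    rw [mul_assoc, trace_mul_comm, mul_assoc, mul_assoc, h]
  rw [Ring.lie_def, sub_mul, trace_sub, this, sub_self]

/-- This is the vanishing of the symplectic form on the velocities ([u, D] + δ, [u, T] + τ) of the
block family: conjugation, change of eigenvalues, change of T. Each mixed term is tr([u, A]B) with A
and B commuting. -/
theorem trace_mul_eq_trace_mul {D T δ τ δ' τ' : Matrix (Fin n) (Fin n) ℂ} (hDT : D * T = T * D)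
    (hτ : D * τ = τ * D) (hτ' : D * τ' = τ' * D) (hδ : T * δ = δ * T) (hδ' : T * δ' = δ' * T)
    (h0 : (δ * τ').trace = 0) (h0' : (δ' * τ).trace = 0) (u u' : Matrix (Fin n) (Fin n) ℂ) :
    ((⁅u, D⁆ + δ) * (⁅u', T⁆ + τ')).trace - ((⁅u', D⁆ + δ') * (⁅u, T⁆ + τ)).trace = 0 := by
  simp only [mul_add, add_mul, trace_add]
  rw [trace_lie_mul_lie_comm hDT u u', trace_lie_mul_of_commute hτ, trace_lie_mul_of_commute hτ',
    trace_mul_comm δ, trace_mul_comm δ', trace_lie_mul_of_commute hδ, trace_lie_mul_of_commute hδ',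
    h0, h0']
  ring

theorem _root_.Matrix.diagonal_mul_comm_of_block {b : Fin n → Fin n} {d : Fin n → ℂ}
    (hd : ∀ i j, b i = b j → d i = d j) {T : Matrix (Fin n) (Fin n) ℂ} (hT : IsBlock b T) :
    diagonal d * T = T * diagonal d := by
  ext i j
  rw [diagonal_mul, mul_diagonal, mul_comm]
  by_cases h : b i = b j
  · rw [hd i j h]
  · rw [hT i j h, zero_mul, zero_mul]

section Tangent

variable {b : Fin n → Fin n} {g T : Matrix (Fin n) (Fin n) ℂ} {d : Fin n → ℂ}

/-- Off the diagonal the elementary matrix E has square zero, so 1 + sE has inverse 1 - sE and the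
conjugates form a polynomial curve. -/
theorem conj_single_mem_tangentSpace (hg : g.det ≠ 0) (hd : ∀ i j, d i = d j ↔ b i = b j)
    (hT : IsHollow b T) {i j : Fin n} (hij : i ≠ j) :
    mk (g * ⁅single i j (1 : ℂ), diagonal d⁆ * g⁻¹) (g * ⁅single i j (1 : ℂ), T⁆ * g⁻¹) ∈
      tangentSpace (blockFamily b) (mk (g * diagonal d * g⁻¹) (g * T * g⁻¹)) := by
  set E : Matrix (Fin n) (Fin n) ℂ := single i j 1 with hE
  have hEE : E * E = 0 := by
    rw [hE, single_mul_single_of_ne _ _ _ _ hij.symm]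
  refine mem_tangentSpace_of_quadratic _ (g * (-(E * diagonal d * E)) * g⁻¹) _
    (g * (-(E * T * E)) * g⁻¹) (Filter.Eventually.of_forall fun s => subset_closure ?_)
  have hinv : (g * (1 + s • E)) * ((1 - s • E) * g⁻¹) = 1 := by
    have : (1 + s • E) * (1 - s • E) = 1 := by
      simp [mul_sub, add_mul, hEE]
    rw [mul_assoc, ← mul_assoc (1 + s • E), this, one_mul, mul_nonsing_inv _
      (isUnit_iff_ne_zero.2 hg)]
  have key : ∀ P : Matrix (Fin n) (Fin n) ℂ,
      g * P * g⁻¹ + s • (g * ⁅E, P⁆ * g⁻¹) + s ^ 2 • (g * (-(E * P * E)) * g⁻¹) =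
        (g * (1 + s • E)) * P * (g * (1 + s • E))⁻¹ := by
    intro P
    rw [inv_eq_right_inv hinv]
    have : (1 + s • E) * P * (1 - s • E) = P + s • ⁅E, P⁆ + s ^ 2 • (-(E * P * E)) := by
      simp only [Ring.lie_def, add_mul, mul_sub, one_mul, mul_one, smul_mul_assoc, mul_smul_comm,
        sq]
      module
    calc _ = g * (P + s • ⁅E, P⁆ + s ^ 2 • (-(E * P * E))) * g⁻¹ := by
          simp only [mul_add, add_mul, mul_smul_comm, smul_mul_assoc]
      _ = _ := by rw [← this]; simp only [mul_assoc]
  rw [base_mk, fib_mk, key, key]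
  refine ⟨g * (1 + s • E), d, T, ?_, hd, hT, rfl⟩
  intro h0
  have := congrArg det hinv
  rw [det_mul, h0, zero_mul, det_one] at this
  exact zero_ne_one this

/-- The velocity of the conjugation of `(gDg⁻¹, gTg⁻¹)` by `g (1 + s u) g⁻¹`. -/
def conjVelocity (g D T : Matrix (Fin n) (Fin n) ℂ) :
    Matrix (Fin n) (Fin n) ℂ →ₗ[ℂ] CotGl n where
  toFun u := mk (g * ⁅u, D⁆ * g⁻¹) (g * ⁅u, T⁆ * g⁻¹)
  map_add' u v := by
    refine Prod.ext ?_ ?_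
    all_goals
      change g * _ * g⁻¹ = g * _ * g⁻¹ + g * _ * g⁻¹
      rw [← add_mul, ← mul_add, add_lie_apply]
  map_smul' c u := by
    refine Prod.ext ?_ ?_
    all_goals
      change g * _ * g⁻¹ = c • (g * _ * g⁻¹)
      simp only [Ring.lie_def, smul_mul_assoc, mul_smul_comm, ← smul_sub]

theorem conjVelocity_mem_tangentSpace (hg : g.det ≠ 0) (hd : ∀ i j, d i = d j ↔ b i = b j)
    (hT : IsHollow b T) {u : Matrix (Fin n) (Fin n) ℂ} (hu : ∀ i, u i i = 0) :
    conjVelocity g (diagonal d) T u ∈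
      tangentSpace (blockFamily b) (mk (g * diagonal d * g⁻¹) (g * T * g⁻¹)) := by
  rw [matrix_eq_sum_single u, map_sum]
  refine Submodule.sum_mem _ fun i _ => ?_
  rw [map_sum]
  refine Submodule.sum_mem _ fun j _ => ?_
  have hsm : single i j (u i j) = u i j • single i j (1 : ℂ) := by simp
  rw [hsm, map_smul]
  by_cases hij : i = j
  · rw [← hij, hu, zero_smul]
    exact Submodule.zero_mem _
  · exact Submodule.smul_mem _ _ (conj_single_mem_tangentSpace hg hd hT hij)

theorem conj_diagonal_mem_tangentSpace (hg : g.det ≠ 0) (hd : ∀ i j, d i = d j ↔ b i = b j)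
    (hT : IsHollow b T) {c : Fin n → ℂ} (hc : ∀ i j, b i = b j → c i = c j) :
    mk (g * diagonal c * g⁻¹) 0 ∈
      tangentSpace (blockFamily b) (mk (g * diagonal d * g⁻¹) (g * T * g⁻¹)) := by
  refine mem_tangentSpace_of_quadratic _ 0 _ 0 ?_
  have hne : ∀ᶠ s : ℂ in Filter.cofinite, ∀ i j, d i + s * c i = d j + s * c j ↔ b i = b j := by
    simp only [Filter.eventually_all]
    intro i j
    by_cases hbij : b i = b j
    · refine Filter.Eventually.of_forall fun s => ?_
      simp [(hd i j).2 hbij, hc i j hbij, hbij]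
    · have h0 : Polynomial.line (d i - d j) (d i - d j + (c i - c j)) ≠ 0 := by
        intro h0
        have := congrArg (Polynomial.eval 0) h0
        simp only [Polynomial.eval_line, zero_mul, add_zero,
          Polynomial.eval_zero, sub_eq_zero] at this
        exact hbij ((hd i j).1 this)
      filter_upwards [Polynomial.eventually_eval_ne_zero h0] with s hs
      rw [Polynomial.eval_line] at hs
      exact ⟨fun h => absurd (by linear_combination h) hs, fun h => absurd h hbij⟩
  filter_upwards [hne] with s hs
  refine subset_closure ⟨g, fun i => d i + s * c i, T, hg, hs, hT, ?_⟩
  have : (diagonal fun i => d i + s * c i) = diagonal d + s • diagonal c := by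
    rw [← diagonal_smul, diagonal_add]; rfl
  rw [this]
  simp [mul_add, add_mul]

theorem conj_hollow_mem_tangentSpace (hg : g.det ≠ 0) (hd : ∀ i j, d i = d j ↔ b i = b j)
    (hT : IsHollow b T) {τ : Matrix (Fin n) (Fin n) ℂ} (hτ : IsHollow b τ) :
    mk 0 (g * τ * g⁻¹) ∈
      tangentSpace (blockFamily b) (mk (g * diagonal d * g⁻¹) (g * T * g⁻¹)) := by
  refine mem_tangentSpace_of_quadratic _ 0 _ 0
    (Filter.Eventually.of_forall fun s => subset_closure ⟨g, d, T + s • τ, hg, hd, ?_, ?_⟩)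
  · intro i j hij
    simp [hT i j hij, hτ i j hij]
  · simp [mul_add, add_mul]

/-- The n² entries of `c` are distributed as follows. Entries outside the blocks give conjugations
that move D; diagonal entries at representatives move the eigenvalues; off-diagonal entries inside
blocks move T. The remaining diagonal entries give conjugations inside a block, which fix D but move
the diagonal of T. -/
theorem exists_isotropic_le_tangentSpace (hb : ∀ i, b (b i) = b i) {q : CotGl n}
    (hq : q ∈ genericBlockFamily b) :
    ∃ W : Submodule ℂ (CotGl n), W ≤ tangentSpace (blockFamily b) q ∧
      n ^ 2 ≤ Module.finrank ℂ W ∧ ∀ v ∈ W, ∀ w ∈ W, symplecticForm v w = 0 := by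
  obtain ⟨g, d, T, hg, hd, hT, hT', rfl⟩ := hq
  -- For a non-representative `i`, the entry at `(i, b i)` is normalized so that it contributes
  -- exactly `c i i` to the i-th diagonal entry of [u, T]. This is where the entries `T (b i) i`
  -- must be nonzero.
  let u : Matrix (Fin n) (Fin n) ℂ → Matrix (Fin n) (Fin n) ℂ := fun c => of fun i j =>
    if b i ≠ b j then c i j else if j = b i ∧ i ≠ j then c i i * (T j i)⁻¹ else 0
  let δ : Matrix (Fin n) (Fin n) ℂ → Fin n → ℂ := fun c i => c (b i) (b i)
  let τ : Matrix (Fin n) (Fin n) ℂ → Matrix (Fin n) (Fin n) ℂ := fun c => of fun i j =>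
    if i ≠ j ∧ b i = b j then c i j else 0
  have hu0 : ∀ c i, u c i i = 0 := by intro c i; simp [u]
  have hτ0 : ∀ c, IsHollow b (τ c) := by
    intro c i j hij
    simp only [τ, of_apply]
    rw [if_neg]
    tauto
  have hδ0 : ∀ c i j, b i = b j → δ c i = δ c j := by intro c i j h; simp [δ, h]
  let L : Matrix (Fin n) (Fin n) ℂ →ₗ[ℂ] CotGl n :=
    { toFun := fun c => mk (g * (⁅u c, diagonal d⁆ + diagonal (δ c)) * g⁻¹)
        (g * (⁅u c, T⁆ + τ c) * g⁻¹)
      map_add' := by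
        intro c c'
        have h1 : u (c + c') = u c + u c' := by
          ext i j; simp only [u, of_apply, Matrix.add_apply]; split_ifs <;> ring
        have h2 : diagonal (δ (c + c')) = diagonal (δ c) + diagonal (δ c') := by
          rw [diagonal_add]; rfl
        have h3 : τ (c + c') = τ c + τ c' := by
          ext i j; simp only [τ, of_apply, Matrix.add_apply]; split_ifs <;> ring
        rw [h1, h2, h3]
        refine Prod.ext ?_ ?_
        all_goals
          change g * _ * g⁻¹ = g * _ * g⁻¹ + g * _ * g⁻¹
          rw [← add_mul, ← mul_add, add_lie_apply, add_add_add_comm]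
      map_smul' := by
        intro r c
        have h1 : u (r • c) = r • u c := by
          ext i j; simp only [u, of_apply, Matrix.smul_apply, smul_eq_mul]; split_ifs <;> ring
        have h2 : diagonal (δ (r • c)) = r • diagonal (δ c) := by
          rw [← diagonal_smul]; rfl
        have h3 : τ (r • c) = r • τ c := by
          ext i j; simp only [τ, of_apply, Matrix.smul_apply, smul_eq_mul]; split_ifs <;> ring
        rw [h1, h2, h3]
        refine Prod.ext ?_ ?_
        all_goals
          change g * _ * g⁻¹ = r • (g * _ * g⁻¹)
          simp only [Ring.lie_def, smul_mul_assoc, mul_smul_comm, ← smul_sub, ← smul_add] }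
  have hLmem : ∀ c, L c ∈ tangentSpace (blockFamily b) (mk (g * diagonal d * g⁻¹) (g * T * g⁻¹)) := by
    intro c
    have : L c = conjVelocity g (diagonal d) T (u c) + mk (g * diagonal (δ c) * g⁻¹) 0 +
        mk 0 (g * τ c * g⁻¹) := by
      refine Prod.ext ?_ ?_
      · change g * _ * g⁻¹ = g * _ * g⁻¹ + g * _ * g⁻¹ + 0
        rw [mul_add, add_mul, add_zero]
      · change g * _ * g⁻¹ = g * _ * g⁻¹ + 0 + g * _ * g⁻¹
        rw [mul_add, add_mul, add_zero]
    rw [this]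
    exact Submodule.add_mem _ (Submodule.add_mem _
      (conjVelocity_mem_tangentSpace hg hd hT (hu0 c))
      (conj_diagonal_mem_tangentSpace hg hd hT (hδ0 c)))
      (conj_hollow_mem_tangentSpace hg hd hT (hτ0 c))
  have hLinj : Function.Injective L := by
    rw [injective_iff_map_eq_zero]
    intro c hc
    have conj0 : ∀ A : Matrix (Fin n) (Fin n) ℂ, g * A * g⁻¹ = 0 → A = 0 := fun A hA => by
      rw [← inv_conj_conj hg A, hA, mul_zero, zero_mul]
    have h1 := conj0 _ (congrArg Prod.fst hc)
    have h2 := conj0 _ (congrArg Prod.snd hc)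
    have e1 : ∀ i j, u c i j * (d j - d i) + diagonal (δ c) i j = 0 := by
      intro i j
      have := congrFun (congrFun h1 i) j
      rw [Matrix.add_apply, Ring.lie_def, Matrix.sub_apply, mul_diagonal, diagonal_mul, Matrix.zero_apply] at this
      linear_combination this
    have hoff : ∀ i j, b i ≠ b j → c i j = 0 := by
      intro i j hij
      have := e1 i j
      rw [diagonal_apply_ne _ (fun h => hij (by rw [h])), add_zero] at this
      have h3 := (mul_eq_zero.1 this).resolve_right
        (sub_ne_zero.2 fun h => hij ((hd i j).1 h.symm))
      simpa [u, hij] using h3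
    have hrep : ∀ i, b i = i → c i i = 0 := by
      intro i hi
      have := e1 i i
      rw [sub_self, mul_zero, zero_add, diagonal_apply_eq] at this
      simpa [δ, hi] using this
    -- In the i-th diagonal entry of the fibre component only the term through `b i` survives:
    -- inside blocks `u` is supported in the columns of representatives, and outside them it
    -- vanishes by `hoff`.
    have hdiag : ∀ i, c i i = 0 := by
      intro i
      by_cases hi : b i = i
      · exact hrep i hi
      have := congrFun (congrFun h2 i) i
      rw [Matrix.add_apply, Ring.lie_def, Matrix.sub_apply, Matrix.zero_apply, hτ0 c i i (Or.inl rfl), add_zero,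
        mul_apply, mul_apply] at this
      rw [Finset.sum_eq_single (b i), Finset.sum_eq_zero, sub_zero] at this
      · simp only [u, of_apply] at this
        rw [if_neg (by simp [hb]), if_pos ⟨trivial, fun h => hi h.symm⟩] at this
        rwa [mul_assoc, inv_mul_cancel₀ (hT' (b i) i hi (hb i)), mul_one] at this
      · intro k _
        by_cases hk : b k = b i
        · simp only [u, of_apply]
          rw [if_neg (not_not.2 hk), if_neg, mul_zero]
          rintro ⟨h3, -⟩
          exact hi (by rw [← hk, ← h3])
        · simp only [u, of_apply]
          rw [if_pos hk, hoff k i hk, mul_zero]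
      · intro k _ hk
        by_cases hki : b i = b k
        · simp only [u, of_apply]
          rw [if_neg (not_not.2 hki), if_neg (fun h => hk h.1), zero_mul]
        · simp only [u, of_apply]
          rw [if_pos hki, hoff i k hki, zero_mul]
      · exact fun h => absurd (Finset.mem_univ _) h
    have hu : u c = 0 := by
      ext i j
      simp only [u, of_apply, Matrix.zero_apply]
      split_ifs with h3 h4
      · exact hoff i j h3
      · rw [hdiag, zero_mul]
      · rfl
    rw [hu, Ring.lie_def, zero_mul, mul_zero, sub_self, zero_add] at h2
    ext i j
    by_cases hij : i = j
    · rw [hij, hdiag]; rfl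
    by_cases hbij : b i = b j
    · have := congrFun (congrFun h2 i) j
      simpa [τ, hij, hbij] using this
    · exact hoff i j hbij
  refine ⟨LinearMap.range L, ?_, ?_, ?_⟩
  · rintro _ ⟨c, rfl⟩
    exact hLmem c
  · rw [LinearMap.finrank_range_of_inj hLinj, Module.finrank_matrix]
    simp [sq]
  · rintro _ ⟨c, rfl⟩ _ ⟨c', rfl⟩
    have htr : ∀ c c', (diagonal (δ c) * τ c').trace = 0 := by
      intro c c'
      rw [trace]
      refine Finset.sum_eq_zero fun i _ => ?_
      rw [diag_apply, diagonal_mul, hτ0 c' i i (Or.inl rfl), mul_zero]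
    change symplecticForm (mk _ _) (mk _ _) = 0
    rw [symplecticForm_conj hg]
    have hd' : ∀ i j, b i = b j → d i = d j := fun i j => (hd i j).2
    exact trace_mul_eq_trace_mul (diagonal_mul_comm_of_block hd' hT.isBlock)
      (diagonal_mul_comm_of_block hd' (hτ0 c).isBlock) (diagonal_mul_comm_of_block hd' (hτ0 c').isBlock)
      (diagonal_mul_comm_of_block (hδ0 c) hT.isBlock).symm (diagonal_mul_comm_of_block (hδ0 c') hT.isBlock).symm
      (htr c c') (htr c' c) _ _

end Tangent

end CotGl

end

/-! ### A slice with n² parameters and the upper bound for the dimension -/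

section

open MvPolynomial Matrix

namespace CotGl

variable {n : ℕ}

section Slice

variable (b : Fin n → Fin n)

/-- The generic matrix with identity diagonal blocks. -/
def sliceG : Matrix (Fin n) (Fin n) (MvPolynomial (Fin n × Fin n) ℂ) :=
  of fun i j => if b i = b j then (if i = j then 1 else 0) else X (i, j)

/-- The generic diagonal matrix that is scalar on the blocks. -/
def sliceD : Matrix (Fin n) (Fin n) (MvPolynomial (Fin n × Fin n) ℂ) :=
  diagonal fun i => X (b i, b i)

/-- The generic block matrix with traceless blocks. -/
def sliceT : Matrix (Fin n) (Fin n) (MvPolynomial (Fin n × Fin n) ℂ) :=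
  of fun i j => if b i = b j then
    (if i = j ∧ b i = i then -∑ k ∈ Finset.univ.filter (fun k => b k = i ∧ k ≠ i), X (k, k)
      else X (i, j)) else 0

theorem det_sliceG_ne_zero : (sliceG b).det ≠ 0 := by
  intro h
  have h1 : (aeval (0 : Fin n × Fin n → ℂ) : _ →ₐ[ℂ] ℂ) (sliceG b).det = 1 := by
    have : (aeval (0 : Fin n × Fin n → ℂ) : _ →ₐ[ℂ] ℂ).mapMatrix (sliceG b) = 1 := by
      ext i j
      simp only [AlgHom.mapMatrix_apply, map_apply, sliceG, of_apply, one_apply]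
      split_ifs with h1 h2 h2 <;> simp_all
    rw [AlgHom.map_det, this, det_one]
  rw [h, map_zero] at h1
  exact zero_ne_one h1

/-- The evaluation of polynomials at the generic point of the slice. -/
def sliceEval :
    MvPolynomial (Idx n) ℂ →ₐ[ℂ] FractionRing (MvPolynomial (Fin n × Fin n) ℂ) :=
  let ev := IsScalarTower.toAlgHom ℂ (MvPolynomial (Fin n × Fin n) ℂ)
    (FractionRing (MvPolynomial (Fin n × Fin n) ℂ))
  aeval (entries ((sliceG b).map ev * (sliceD b).map ev * ((sliceG b).map ev)⁻¹)
    ((sliceG b).map ev * (sliceT b).map ev * ((sliceG b).map ev)⁻¹))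

variable {b}

/-- A polynomial that vanishes at the generic point of the slice has zero numerator, so it vanishes
at every specialization with invertible `sliceG`. -/
theorem eval_slice_eq_zero {f : MvPolynomial (Idx n) ℂ} (hf : sliceEval b f = 0)
    (ev : MvPolynomial (Fin n × Fin n) ℂ →ₐ[ℂ] ℂ)
    (hm : ((sliceG b).map ev).det ≠ 0) :
    eval (mk ((sliceG b).map ev * (sliceD b).map ev * ((sliceG b).map ev)⁻¹)
      ((sliceG b).map ev * (sliceT b).map ev * ((sliceG b).map ev)⁻¹)).coords f = 0 := by
  obtain ⟨N, k, hN⟩ := exists_numerator_conj (sliceG b) (sliceD b) (sliceT b) f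
  have hN0 : N = 0 := by
    apply IsFractionRing.injective (MvPolynomial (Fin n × Fin n) ℂ)
      (FractionRing (MvPolynomial (Fin n × Fin n) ℂ))
    rw [map_zero]
    have := hN _ (IsScalarTower.toAlgHom ℂ (MvPolynomial (Fin n × Fin n) ℂ)
      (FractionRing (MvPolynomial (Fin n × Fin n) ℂ))) (by
        rw [← AlgHom.mapMatrix_apply, ← AlgHom.map_det]
        exact fun h => det_sliceG_ne_zero b (IsFractionRing.injective _ _ (h.trans (map_zero _).symm)))
    exact this.trans (by
      change _ * sliceEval b f = 0
      rw [hf, mul_zero])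
  have := hN ℂ ev hm
  rw [hN0, map_zero, aeval_eq_eval, ← coords_mk] at this
  exact (mul_eq_zero.1 this.symm).resolve_left (pow_ne_zero _ hm)

/-- Block matrices are the commutant of the diagonal matrix with entries `b i`, and commutants are
stable under inverses. -/
theorem isBlock_inv {l : Matrix (Fin n) (Fin n) ℂ} (hl : IsBlock b l) (hdet : l.det ≠ 0) :
    IsBlock b l⁻¹ := by
  have hu := isUnit_iff_ne_zero.2 hdet
  have h := diagonal_mul_comm_of_block (b := b) (d := fun i => ((b i : ℕ) : ℂ))
    (fun i j h => by rw [h]) hl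
  set Δ : Matrix (Fin n) (Fin n) ℂ := diagonal fun i => ((b i : ℕ) : ℂ) with hΔ
  have h' : Δ * l⁻¹ = l⁻¹ * Δ := by
    calc Δ * l⁻¹ = l⁻¹ * (l * Δ) * l⁻¹ := by rw [← mul_assoc, nonsing_inv_mul l hu, one_mul]
      _ = l⁻¹ * Δ := by rw [← h, mul_assoc, mul_assoc, mul_nonsing_inv l hu, mul_one]
  intro i j hij
  have := congrFun (congrFun h' i) j
  rw [hΔ, diagonal_mul, mul_diagonal] at this
  have h2 : (((b i : ℕ) : ℂ) - ((b j : ℕ) : ℂ)) * l⁻¹ i j = 0 := by linear_combination this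
  refine (mul_eq_zero.1 h2).resolve_left fun h3 => hij (Fin.ext ?_)
  exact Nat.cast_injective (sub_eq_zero.1 h3)

theorem isBlock_mul {A B : Matrix (Fin n) (Fin n) ℂ} (hA : IsBlock b A) (hB : IsBlock b B) :
    IsBlock b (A * B) := by
  intro i j hij
  rw [mul_apply]
  refine Finset.sum_eq_zero fun k _ => ?_
  by_cases h : b i = b k
  · rw [hB k j (h ▸ hij), mul_zero]
  · rw [hA i k h, zero_mul]

/-- With `l` the block part of `g`, the matrix g l⁻¹ has identity diagonal blocks. Since `l`
commutes with D, replacing T by l T l⁻¹ leaves the point unchanged and puts it in the slice. -/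
theorem eval_conj_eq_zero_of_det_block_ne_zero (hb : ∀ i, b (b i) = b i)
    {f : MvPolynomial (Idx n) ℂ} (hf : sliceEval b f = 0) {g T : Matrix (Fin n) (Fin n) ℂ}
    {d : Fin n → ℂ} (hg : g.det ≠ 0) (hd : ∀ i j, b i = b j → d i = d j) (hT : IsHollow b T)
    {l : Matrix (Fin n) (Fin n) ℂ} (hl : IsBlock b l) (hlg : ∀ i j, b i = b j → l i j = g i j)
    (hdet : l.det ≠ 0) :
    eval (mk (g * diagonal d * g⁻¹) (g * T * g⁻¹)).coords f = 0 := by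
  have hu := isUnit_iff_ne_zero.2 hdet
  have hl' := isBlock_inv hl hdet
  set g' := g * l⁻¹ with hg'
  set T' := l * T * l⁻¹ with hT'
  have hT'b : IsBlock b T' := isBlock_mul (isBlock_mul hl hT.isBlock) hl'
  have hg'det : g'.det ≠ 0 := by
    rw [hg', det_mul, det_nonsing_inv, Ring.inverse_eq_inv']
    exact mul_ne_zero hg (inv_ne_zero hdet)
  have hg'inv : g'⁻¹ = l * g⁻¹ := by
    apply inv_eq_right_inv
    rw [hg', mul_assoc, ← mul_assoc l⁻¹, nonsing_inv_mul l hu, one_mul,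
      mul_nonsing_inv g (isUnit_iff_ne_zero.2 hg)]
  have hconj : ∀ P, g' * (l * P * l⁻¹) * g'⁻¹ = g * P * g⁻¹ := by
    intro P
    have h1 := nonsing_inv_mul l hu
    calc g' * (l * P * l⁻¹) * g'⁻¹ = g * (l⁻¹ * l) * P * (l⁻¹ * l) * g⁻¹ := by
          rw [hg'inv, hg']; simp only [mul_assoc]
      _ = g * P * g⁻¹ := by rw [h1, mul_one, mul_one]
  have hlD : l * diagonal d * l⁻¹ = diagonal d := by
    rw [← diagonal_mul_comm_of_block hd hl, mul_assoc, mul_nonsing_inv l hu, mul_one]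
  -- Conjugation by `l` destroys hollowness but preserves the trace of each block; hence the
  -- traceless blocks in `sliceT`.
  have htr : ∀ i, ∑ k ∈ Finset.univ.filter (fun k => b k = i), T' k k = 0 := by
    intro i
    set P : Matrix (Fin n) (Fin n) ℂ := diagonal fun k => if b k = i then 1 else 0 with hP
    have h1 : ∀ A : Matrix (Fin n) (Fin n) ℂ, (P * A).trace =
        ∑ k ∈ Finset.univ.filter (fun k => b k = i), A k k := by
      intro A
      rw [trace, Finset.sum_filter]
      refine Finset.sum_congr rfl fun k _ => ?_
      rw [diag_apply, hP, diagonal_mul]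
      split_ifs <;> simp
    have hPl : P * l = l * P := diagonal_mul_comm_of_block (fun k j h => by rw [h]) hl
    rw [← h1, hT', ← mul_assoc, ← mul_assoc, hPl, trace_mul_comm, mul_assoc l, ← mul_assoc,
      nonsing_inv_mul l hu, one_mul, h1]
    exact Finset.sum_eq_zero fun k _ => hT k k (Or.inl rfl)
  -- Each index pair serves one factor: pairs outside the blocks give `sliceG`, diagonal pairs at
  -- representatives give `sliceD`, and the other pairs inside blocks give `sliceT`.
  let m : Fin n × Fin n → ℂ := fun ij => if b ij.1 ≠ b ij.2 then g' ij.1 ij.2 else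
    if ij.1 = ij.2 ∧ b ij.1 = ij.1 then d ij.1 else T' ij.1 ij.2
  set ev : MvPolynomial (Fin n × Fin n) ℂ →ₐ[ℂ] ℂ := aeval m with hev
  have hG : (sliceG b).map ev = g' := by
    ext i j
    rw [map_apply, sliceG, of_apply]
    by_cases hij : b i = b j
    · have h1 : g' i j = (1 : Matrix (Fin n) (Fin n) ℂ) i j := by
        rw [← mul_nonsing_inv l hu, hg', mul_apply, mul_apply]
        refine Finset.sum_congr rfl fun k _ => ?_
        by_cases hk : b k = b j
        · rw [hlg i k (hij.trans hk.symm)]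
        · rw [hl' k j hk, mul_zero, mul_zero]
      rw [if_pos hij, h1, one_apply]
      split_ifs <;> simp
    · rw [if_neg hij, hev, aeval_X]
      simp [m, hij]
  have hD : (sliceD b).map ev = diagonal d := by
    rw [sliceD, diagonal_map (map_zero _)]
    congr 1
    ext i
    rw [hev, aeval_X]
    simp [m, hb, hd (b i) i (hb i)]
  have hTm : (sliceT b).map ev = T' := by
    ext i j
    rw [map_apply, sliceT, of_apply]
    by_cases hij : b i = b j
    · rw [if_pos hij]
      by_cases hr : i = j ∧ b i = i
      · obtain ⟨rfl, hi⟩ := hr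
        rw [if_pos ⟨rfl, hi⟩, map_neg, map_sum]
        have h1 := htr i
        rw [← Finset.sum_erase_add (Finset.univ.filter fun k => b k = i) _
          (Finset.mem_filter.2 ⟨Finset.mem_univ i, hi⟩)] at h1
        rw [← neg_eq_of_add_eq_zero_right h1, neg_inj]
        refine Finset.sum_congr ?_ fun k hk => ?_
        · ext k; simp [and_comm]
        · rw [Finset.mem_erase, Finset.mem_filter] at hk
          rw [hev, aeval_X]
          have : b k ≠ k := by rw [hk.2.2]; exact hk.1.symm
          simp [m, this]
      · rw [if_neg hr, hev, aeval_X]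
        simp only [m]
        rw [if_neg (not_not.2 hij), if_neg hr]
    · rw [if_neg hij, map_zero, hT'b i j hij]
  have key := eval_slice_eq_zero hf ev (by rw [hG]; exact hg'det)
  rwa [hG, hD, hTm, ← hlD, hT', hconj, hconj] at key

theorem eventually_det_add_smul_ne_zero (l : Matrix (Fin n) (Fin n) ℂ) :
    ∀ᶠ s : ℂ in Filter.cofinite, (l + s • (1 : Matrix (Fin n) (Fin n) ℂ)).det ≠ 0 := by
  filter_upwards [Polynomial.eventually_eval_ne_zero (charpoly_monic (-l)).ne_zero] with s hs
  rw [eval_charpoly] at hs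
  rwa [sub_neg_eq_add, add_comm, scalar_apply, ← smul_one_eq_diagonal] at hs

/-- The block part of `g` may be singular. Replacing `g` by g + s makes it invertible for almost all
s, and s = 0 is recovered along this line. -/
theorem ker_sliceEval_le (hb : ∀ i, b (b i) = b i) :
    RingHom.ker (sliceEval b) ≤ ideal (blockFamily b) := by
  intro f hf
  rw [RingHom.mem_ker] at hf
  rw [mem_ideal]
  rintro _ ⟨g, d, T, hg, hd, hT, rfl⟩
  have key := eval_conj_eq_zero_of_eventually (G := line g (g + 1))
    (D := (diagonal d).map Polynomial.C) (T := T.map Polynomial.C) (f := f) (by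
      filter_upwards [eventually_det_add_smul_ne_zero
        (of fun i j => if b i = b j then g i j else 0)] with s hs hs'
      rw [evalAt_map_C, evalAt_map_C]
      refine eval_conj_eq_zero_of_det_block_ne_zero hb hf hs' (fun i j => (hd i j).2) hT ?_ ?_ hs
      · intro i j hij
        have : i ≠ j := fun h => hij (by rw [h])
        simp [hij, this]
      · intro i j hij
        rw [evalAt_line]
        simp [hij]) 0
  rw [evalAt_line, zero_smul, add_zero, evalAt_map_C, evalAt_map_C] at key
  exact key hg

/-- The coordinate ring is a quotient of the image of `sliceEval`, which lies in the field of
rational functions in n² variables. -/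
theorem dim_blockFamily_le (hb : ∀ i, b (b i) = b i) :
    dim (blockFamily b) ≤ ((n ^ 2 : ℕ) : WithBot ℕ∞) := by
  have htr : Algebra.trdeg ℂ (FractionRing (MvPolynomial (Fin n × Fin n) ℂ)) ≤ (n ^ 2 : ℕ) := by
    have h1 := trdeg_add_eq ℂ (MvPolynomial (Fin n × Fin n) ℂ)
      (A := FractionRing (MvPolynomial (Fin n × Fin n) ℂ))
    have : Algebra.IsAlgebraic (MvPolynomial (Fin n × Fin n) ℂ)
      (FractionRing (MvPolynomial (Fin n × Fin n) ℂ)) :=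
      IsLocalization.isAlgebraic _ (nonZeroDivisors (MvPolynomial (Fin n × Fin n) ℂ))
    rw [trdeg_eq_zero (R := MvPolynomial (Fin n × Fin n) ℂ), add_zero, MvPolynomial.trdeg_of_isDomain] at h1
    rw [← h1]
    simp [sq]
  have := Ideal.Quotient.nontrivial_iff.2 (RingHom.ker_ne_top (sliceEval b))
  have h2 := ringKrullDim_le_of_injective_of_trdeg_le (Ideal.kerLiftAlg (sliceEval b))
    (Ideal.kerLiftAlg_injective _) htr
  refine le_trans ?_ h2
  exact ringKrullDim_le_of_surjective (Ideal.Quotient.factor (ker_sliceEval_le hb))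
    (Ideal.Quotient.factor_surjective _)

end Slice

end CotGl

end

/-! ### Distinct partitions have distinct closures -/

section

open MvPolynomial Matrix

namespace MvPolynomial

variable {κ ι : Type*} [Fintype ι]

/-- The comparison from polynomials in countably many variables that sends the variables to the
coefficients of the monic polynomial with the roots `X (c i)`. -/
def coeffHom (c : ι → κ) : MvPolynomial ℕ ℂ →ₐ[ℂ] MvPolynomial κ ℂ :=
  aeval (∏ i, (Polynomial.X - Polynomial.C (X (c i) : MvPolynomial κ ℂ))).coeff

theorem aeval_coeffHom (c : ι → κ) (δ : κ → ℂ) (r : MvPolynomial ℕ ℂ) :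
    aeval δ (coeffHom c r) =
      aeval (∏ i, (Polynomial.X - Polynomial.C (δ (c i)))).coeff r := by
  rw [← AlgHom.comp_apply]
  congr 1
  ext k
  have : (∏ i, (Polynomial.X - Polynomial.C (δ (c i)))) =
      (∏ i, (Polynomial.X - Polynomial.C (X (c i) : MvPolynomial κ ℂ))).map
        (aeval δ : MvPolynomial κ ℂ →ₐ[ℂ] ℂ).toRingHom := by
    simp [Polynomial.map_prod]
  rw [AlgHom.comp_apply, coeffHom, aeval_X, aeval_X, this, Polynomial.coeff_map]
  rfl

/-- Each variable `X (c i)` is a root of the monic product, whose coefficients are images of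
variables. -/
theorem isIntegral_coeffHom {c : ι → κ} (hc : Function.Surjective c) :
    (coeffHom c).toRingHom.IsIntegral := by
  let _ := (coeffHom c).toRingHom.toAlgebra
  have : IsScalarTower ℂ (MvPolynomial ℕ ℂ) (MvPolynomial κ ℂ) :=
    .of_algebraMap_eq' (coeffHom c).comp_algebraMap.symm
  have hX : ∀ k : κ, IsIntegral (MvPolynomial ℕ ℂ) (X k : MvPolynomial κ ℂ) := by
    intro k
    obtain ⟨i, rfl⟩ := hc k
    set P := ∏ i, (Polynomial.X - Polynomial.C (X (c i) : MvPolynomial κ ℂ)) with hP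
    obtain ⟨Q, hQ, -, hQm⟩ := Polynomial.lifts_and_degree_eq_and_monic
      (f := (coeffHom c).toRingHom) (p := P)
      ((Polynomial.lifts_iff_coeff_lifts _).2 fun k => ⟨X k, aeval_X _ _⟩)
      (Polynomial.monic_prod_X_sub_C _ _)
    refine ⟨Q, hQm, ?_⟩
    rw [← Polynomial.eval_map]
    change (Q.map (coeffHom c).toRingHom).eval _ = 0
    rw [hQ, hP, Polynomial.eval_prod]
    exact Finset.prod_eq_zero (Finset.mem_univ i) (by simp)
  intro p
  change IsIntegral (MvPolynomial ℕ ℂ) p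
  induction p using MvPolynomial.induction_on with
  | C a =>
    have : (C a : MvPolynomial κ ℂ) = algebraMap (MvPolynomial ℕ ℂ) _ (C a) :=
      ((coeffHom c).commutes a).symm
    rw [this]
    exact isIntegral_algebraMap
  | add p q hp hq => exact hp.add hq
  | mul_X p k hp => exact hp.mul (hX k)

/-- The polynomials whose roots have prescribed coincidences are those whose coefficients satisfy
all polynomial relations that hold for these polynomials. -/
theorem exists_roots_of_ker_coeffHom_le [Finite κ] {c : ι → κ} (hc : Function.Surjective c)
    (p : Polynomial ℂ)
    (h : ∀ r : MvPolynomial ℕ ℂ, coeffHom c r = 0 → aeval p.coeff r = 0) :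
    ∃ δ : κ → ℂ, p = ∏ i, (Polynomial.X - Polynomial.C (δ (c i))) := by
  let _ := (coeffHom c).toRingHom.toAlgebra
  have : Algebra.IsIntegral (MvPolynomial ℕ ℂ) (MvPolynomial κ ℂ) := ⟨isIntegral_coeffHom hc⟩
  have hmem : ∀ r, r ∈ vanishingIdeal ℂ {p.coeff} ↔ aeval p.coeff r = 0 := by
    intro r
    simp [mem_vanishingIdeal_iff]
  -- By `h`, the maximal ideal of the point `p.coeff` contains the kernel, so a maximal ideal lies
  -- over it. By the Nullstellensatz that ideal is a point `δ`.
  obtain ⟨Q, hQ, hQp⟩ := Ideal.exists_ideal_over_maximal_of_isIntegral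
    (S := MvPolynomial κ ℂ) (vanishingIdeal ℂ {p.coeff} : Ideal (MvPolynomial ℕ ℂ))
    (fun r hr => (hmem r).2 (h r hr))
  obtain ⟨δ, rfl⟩ := isMaximal_iff_eq_vanishingIdeal_singleton.1 hQ
  refine ⟨δ, Polynomial.ext fun k => ?_⟩
  have h1 : (X k - C (p.coeff k) : MvPolynomial ℕ ℂ) ∈
      Ideal.comap (algebraMap _ (MvPolynomial κ ℂ)) (vanishingIdeal ℂ {δ}) := by
    rw [hQp, hmem]
    simp
  have h2 : aeval δ (coeffHom c (X k - C (p.coeff k))) = 0 :=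
    mem_vanishingIdeal_iff.1 (Ideal.mem_comap.1 h1) δ rfl
  rw [aeval_coeffHom, map_sub, aeval_X, aeval_C] at h2
  exact (sub_eq_zero.1 h2).symm

end MvPolynomial

namespace CotGl

variable {n : ℕ}

theorem charpoly_eq_prod_of_stratum {μ : n.Partition} {b : Fin n → Fin n}
    (hμ : fiberCards b = μ.parts) {q : CotGl n} (hq : q ∈ stratum μ) :
    ∃ δ : Set.range b → ℂ, q.base.charpoly =
      ∏ i, (Polynomial.X - Polynomial.C (δ (Set.rangeFactorization b i))) := by
  obtain ⟨-, hq⟩ := hq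
  obtain ⟨g, d, hg, hx, hd⟩ := isDiagonalizableOfType_iff.1 hq
  obtain ⟨σ, hσ⟩ := exists_perm_of_fiberCards_eq d b (hd.trans hμ.symm)
  refine ⟨fun k => d (σ k.2.choose), ?_⟩
  rw [hx, charpoly_conj hg, charpoly_diagonal, ← Equiv.prod_comp σ]
  refine Finset.prod_congr rfl fun i _ => ?_
  congr 2
  rw [hσ]
  exact (Set.rangeFactorization b i).2.choose_spec.symm

/-- On the stratum the coefficients of the characteristic polynomial satisfy every relation that
holds for monic polynomials whose roots coincide according to `b`. These relations pass to the
closure, where they suffice to produce such roots. -/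
theorem exists_charpoly_eq_prod_of_mem_closure {μ : n.Partition} {b : Fin n → Fin n}
    (hμ : fiberCards b = μ.parts) {p : CotGl n} (hp : p ∈ closure (stratum μ)) :
    ∃ δ : Fin n → ℂ, p.base.charpoly = ∏ i, (Polynomial.X - Polynomial.C (δ (b i))) := by
  let G : Matrix (Fin n) (Fin n) (MvPolynomial (Idx n) ℂ) := of fun i j => X (Sum.inl (i, j))
  have hG : ∀ (q : CotGl n) (r : MvPolynomial ℕ ℂ),
      eval q.coords (aeval G.charpoly.coeff r) = aeval q.base.charpoly.coeff r := by
    intro q r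
    rw [← aeval_eq_eval, ← AlgHom.comp_apply]
    congr 1
    ext k
    have h1 : q.base = G.map (eval q.coords) := by
      ext i j
      simp [G, coords]
    rw [AlgHom.comp_apply, aeval_X, aeval_X, h1, charpoly_map, Polynomial.coeff_map]
    rfl
  obtain ⟨δ, hδ⟩ := exists_roots_of_ker_coeffHom_le (c := Set.rangeFactorization b)
    Set.rangeFactorization_surjective p.base.charpoly (fun r hr => by
      rw [← hG]
      refine (mem_closure_iff.1 hp) _ (mem_ideal.2 fun q hq => ?_)
      obtain ⟨δ, hδ⟩ := charpoly_eq_prod_of_stratum hμ hq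
      rw [hG, hδ, ← aeval_coeffHom, hr, map_zero])
  classical
  refine ⟨fun k => if h : k ∈ Set.range b then δ ⟨k, h⟩ else 0, hδ.trans ?_⟩
  refine Finset.prod_congr rfl fun i _ => ?_
  simp [Set.rangeFactorization]

/-- If the closure of the stratum of `μ` contains that of `ν`, then `ν` arises from `μ` by merging
blocks. -/
theorem exists_parts_eq_fiberCards_comp {μ ν : n.Partition} {b : Fin n → Fin n}
    (hμ : fiberCards b = μ.parts) (h : stratum ν ⊆ closure (stratum μ)) :
    ∃ δ : Fin n → ℂ, ν.parts = fiberCards (δ ∘ b) := by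
  obtain ⟨c, hc, hν⟩ := exists_idempotent_fiberCards ν
  obtain ⟨q, hq⟩ := genericBlockFamily_nonempty c
  have hq' := blockFamily_subset_stratum hc hν (genericBlockFamily_subset c hq)
  obtain ⟨δ, hδ⟩ := exists_charpoly_eq_prod_of_mem_closure hμ (h hq')
  obtain ⟨g, d, hg, hx, hd⟩ := isDiagonalizableOfType_iff.1 hq'.2
  refine ⟨δ, ?_⟩
  have h1 := roots_charpoly_conj_diagonal hg d
  have h2 := roots_charpoly_conj_diagonal (n := n) (g := 1) (by simp) (δ ∘ b)
  rw [← hx, hδ] at h1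
  rw [charpoly_conj (by simp), charpoly_diagonal] at h2
  rw [← hd, fiberCards_eq_dedup, fiberCards_eq_dedup, ← h1, ← h2]
  rfl

/-- A partition is determined by the Zariski closure of its stratum. -/
theorem eq_of_stratum_subset_closure {μ ν : n.Partition}
    (h : stratum ν ⊆ closure (stratum μ)) (h' : stratum μ ⊆ closure (stratum ν)) : μ = ν := by
  obtain ⟨b, -, hμ⟩ := exists_idempotent_fiberCards μ
  obtain ⟨c, -, hν⟩ := exists_idempotent_fiberCards ν
  obtain ⟨δ, hδ⟩ := exists_parts_eq_fiberCards_comp hμ h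
  obtain ⟨ε, hε⟩ := exists_parts_eq_fiberCards_comp hν h'
  refine Nat.Partition.ext ?_
  -- Merging in both directions makes the numbers of parts equal, so no merging takes place.
  rw [hδ, ← hμ, fiberCards_comp_of_card_le b δ]
  rw [hμ, hε, ← hδ, ← hν]
  exact card_fiberCards_comp_le c ε

end CotGl

end

/-! ### Endomorphisms of products of cyclic modules as matrices -/

section

open Polynomial

section CyclicQuotient

variable {R : Type*} [CommRing R] [Nontrivial R]

theorem mk_modByMonic {P : R[X]} (hP : P.Monic) (f : R[X]) :
    Ideal.Quotient.mk (Ideal.span {P}) (f %ₘ P) = Ideal.Quotient.mk _ f := by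
  refine Ideal.Quotient.eq.2 (Ideal.mem_span_singleton.2 ?_)
  rw [← modByMonic_eq_zero_iff_dvd hP, sub_modByMonic,
    (modByMonic_eq_self_iff hP).2 (degree_modByMonic_lt f hP), sub_self]

/-- The remainders modulo a monic polynomial of degree `e` are the classes modulo it. -/
def quotEquiv {P : R[X]} (hP : P.Monic) {e : ℕ} (he : P.natDegree = e) :
    (Fin e → R) ≃ₗ[R] (R[X] ⧸ Ideal.span {P}) :=
  LinearEquiv.ofBijective
    (((Ideal.span {P}).mkQ.restrictScalars R) ∘ₗ (degreeLT R e).subtype ∘ₗ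
      (degreeLTEquiv R e).symm.toLinearMap) (by
    have hdeg : P.degree = e := by rw [degree_eq_natDegree hP.ne_zero, he]
    constructor
    · rw [← LinearMap.ker_eq_bot, LinearMap.ker_eq_bot']
      intro v hv
      have h1 : P ∣ ((degreeLTEquiv R e).symm v : R[X]) :=
        Ideal.mem_span_singleton.1 ((Submodule.Quotient.mk_eq_zero _).1 hv)
      have h2 := mem_degreeLT.1 ((degreeLTEquiv R e).symm v).2
      rw [← hdeg, ← modByMonic_eq_self_iff hP, (modByMonic_eq_zero_iff_dvd hP).2 h1] at h2
      have h3 : (degreeLTEquiv R e).symm v = 0 := Subtype.ext h2.symm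
      simpa using h3
    · intro q
      obtain ⟨f, rfl⟩ := Submodule.Quotient.mk_surjective _ q
      refine ⟨degreeLTEquiv R e ⟨f %ₘ P, mem_degreeLT.2 (hdeg ▸ degree_modByMonic_lt f hP)⟩, ?_⟩
      simp only [LinearMap.comp_apply, LinearEquiv.coe_coe, LinearEquiv.symm_apply_apply]
      exact mk_modByMonic hP f)

theorem quotEquiv_apply {P : R[X]} (hP : P.Monic) {e : ℕ} (he : P.natDegree = e)
    (v : Fin e → R) :
    quotEquiv hP he v = Ideal.Quotient.mk _ ((degreeLTEquiv R e).symm v : R[X]) := rfl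

/-- The basis of the powers of the variable. -/
def quotBasis {P : R[X]} (hP : P.Monic) {e : ℕ} (he : P.natDegree = e) :
    Module.Basis (Fin e) R (R[X] ⧸ Ideal.span {P}) :=
  .ofEquivFun (quotEquiv hP he).symm

theorem quotBasis_repr {P : R[X]} (hP : P.Monic) {e : ℕ} (he : P.natDegree = e) (f : R[X])
    (i : Fin e) :
    (quotBasis hP he).repr (Ideal.Quotient.mk _ f) i = (f %ₘ P).coeff i := by
  have hdeg : P.degree = e := by rw [degree_eq_natDegree hP.ne_zero, he]
  have h : (quotEquiv hP he).symm (Ideal.Quotient.mk _ f) =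
      degreeLTEquiv R e ⟨f %ₘ P, mem_degreeLT.2 (hdeg ▸ degree_modByMonic_lt f hP)⟩ := by
    rw [LinearEquiv.symm_apply_eq, quotEquiv_apply, LinearEquiv.symm_apply_apply]
    exact (mk_modByMonic hP f).symm
  change (quotEquiv hP he).symm (Ideal.Quotient.mk _ f) i = _
  rw [h]
  rfl

theorem quotBasis_apply {P : R[X]} (hP : P.Monic) {e : ℕ} (he : P.natDegree = e) (i : Fin e) :
    quotBasis hP he i = Ideal.Quotient.mk _ (X ^ (i : ℕ)) := by
  have hdeg : P.degree = e := by rw [degree_eq_natDegree hP.ne_zero, he]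
  apply (quotBasis hP he).repr.injective
  ext j
  rw [quotBasis_repr, (modByMonic_eq_self_iff hP).2, coeff_X_pow, Module.Basis.repr_self,
    Finsupp.single_apply]
  · simp [Fin.ext_iff, eq_comm]
  · rw [degree_X_pow, hdeg]
    exact_mod_cast i.2

end CyclicQuotient

section BlockMatrix

variable {R : Type*} [CommRing R] {ι : Type*}

/-- The matrix, in the bases of the powers of the variable, of the homomorphism with components
`G j i : R[X] / (P i) → R[X] / (P j)`. -/
def blockMatrix (e : ι → ℕ) (P : ι → R[X]) (G : ι → ι → R[X]) :
    Matrix (Σ i, Fin (e i)) (Σ i, Fin (e i)) R :=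
  Matrix.of fun p q => ((G p.1 q.1 * X ^ (q.2 : ℕ)) %ₘ P p.1).coeff p.2

/-- Division with remainder by a monic polynomial commutes with base change, so the families built
over ℂ[s] specialize entrywise. -/
theorem blockMatrix_map {S : Type*} [CommRing S] (φ : R →+* S) (e : ι → ℕ) {P : ι → R[X]}
    (hP : ∀ i, (P i).Monic) (G : ι → ι → R[X]) :
    (blockMatrix e P G).map φ = blockMatrix e (fun i => (P i).map φ) fun j i => (G j i).map φ := by
  ext p q
  simp [blockMatrix, ← coeff_map, map_modByMonic φ (hP _)]

variable [Fintype ι] [DecidableEq ι] [Nontrivial R] {e : ι → ℕ} {P : ι → R[X]}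

/-- The basis of a product of cyclic modules. -/
def piQuotBasis (hP : ∀ i, (P i).Monic) (he : ∀ i, (P i).natDegree = e i) :
    Module.Basis (Σ i, Fin (e i)) R (∀ i, R[X] ⧸ Ideal.span {P i}) :=
  Pi.basis fun i => quotBasis (hP i) (he i)

theorem toMatrix_eq_blockMatrix (hP : ∀ i, (P i).Monic) (he : ∀ i, (P i).natDegree = e i)
    {G : ι → ι → R[X]}
    (Y : (∀ i, R[X] ⧸ Ideal.span {P i}) →ₗ[R[X]] (∀ i, R[X] ⧸ Ideal.span {P i}))
    (hY : ∀ i j, Y (Pi.single i (Ideal.Quotient.mk _ 1)) j = Ideal.Quotient.mk _ (G j i)) :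
    LinearMap.toMatrix (piQuotBasis hP he) (piQuotBasis hP he) (Y.restrictScalars R) =
      blockMatrix e P G := by
  ext ⟨j, b⟩ ⟨i, a⟩
  rw [LinearMap.toMatrix_apply, piQuotBasis, Pi.basis_repr, Pi.basis_apply, quotBasis_apply]
  have h1 : (Pi.single i (Ideal.Quotient.mk _ (X ^ (a : ℕ))) : ∀ i, R[X] ⧸ Ideal.span {P i}) =
      (X ^ (a : ℕ) : R[X]) • Pi.single i (Ideal.Quotient.mk _ 1) := by
    rw [← Pi.single_smul]
    congr 1
    rw [← Ideal.Quotient.mk_eq_mk, ← Ideal.Quotient.mk_eq_mk, ← Submodule.Quotient.mk_smul,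
      smul_eq_mul, mul_one]
  rw [LinearMap.restrictScalars_apply, h1, map_smul, Pi.smul_apply, hY, ← Ideal.Quotient.mk_eq_mk,
    ← Submodule.Quotient.mk_smul, Ideal.Quotient.mk_eq_mk, quotBasis_repr, smul_eq_mul, mul_comm]
  rfl

/-- `G j i` lifts the j-th component of the image of the i-th generator. The divisibility says that
`P i` kills this image, as it kills the generator. -/
theorem exists_toMatrix_eq_blockMatrix (hP : ∀ i, (P i).Monic)
    (he : ∀ i, (P i).natDegree = e i)
    (Y : (∀ i, R[X] ⧸ Ideal.span {P i}) →ₗ[R[X]] (∀ i, R[X] ⧸ Ideal.span {P i})) :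
    ∃ G : ι → ι → R[X], (∀ i j, P j ∣ G j i * P i) ∧
      LinearMap.toMatrix (piQuotBasis hP he) (piQuotBasis hP he) (Y.restrictScalars R) =
        blockMatrix e P G := by
  choose G hG using fun j i => Ideal.Quotient.mk_surjective
    (Y (Pi.single i (Ideal.Quotient.mk _ 1)) j)
  refine ⟨G, fun i j => ?_, toMatrix_eq_blockMatrix hP he Y fun i j => (hG j i).symm⟩
  rw [← Ideal.Quotient.eq_zero_iff_dvd, mul_comm, ← smul_eq_mul, ← Ideal.Quotient.mk_eq_mk,
    Submodule.Quotient.mk_smul, Ideal.Quotient.mk_eq_mk, hG, ← Pi.smul_apply, ← map_smul,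
    ← Pi.single_smul]
  have : P i • (Ideal.Quotient.mk (Ideal.span {P i}) 1) = 0 := by
    rw [← Ideal.Quotient.mk_eq_mk, ← Submodule.Quotient.mk_smul, smul_eq_mul, mul_one,
      Ideal.Quotient.mk_eq_mk, Ideal.Quotient.eq_zero_iff_dvd]
  rw [this, Pi.single_zero, map_zero, Pi.zero_apply]

/-- The homomorphism with components `G j i : R[X] / (P i) → R[X] / (P j)`. -/
def blockHom (G : ι → ι → R[X]) (hG : ∀ i j, P j ∣ G j i * P i) :
    (∀ i, R[X] ⧸ Ideal.span {P i}) →ₗ[R[X]] (∀ i, R[X] ⧸ Ideal.span {P i}) :=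
  LinearMap.pi fun j => ∑ i, (Submodule.mapQ (Ideal.span {P i}) (Ideal.span {P j})
    (LinearMap.mulLeft R[X] (G j i)) (by
      rw [Ideal.span, Submodule.span_singleton_le_iff_mem, Submodule.mem_comap]
      exact Ideal.mem_span_singleton.2 (hG i j))) ∘ₗ LinearMap.proj i

theorem toMatrix_blockHom (hP : ∀ i, (P i).Monic) (he : ∀ i, (P i).natDegree = e i)
    (G : ι → ι → R[X]) (hG : ∀ i j, P j ∣ G j i * P i) :
    LinearMap.toMatrix (piQuotBasis hP he) (piQuotBasis hP he)
      ((blockHom G hG).restrictScalars R) = blockMatrix e P G := by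
  refine toMatrix_eq_blockMatrix hP he _ fun i j => ?_
  rw [blockHom, LinearMap.pi_apply, LinearMap.sum_apply, Finset.sum_eq_single i]
  · rw [LinearMap.comp_apply, LinearMap.proj_apply, Pi.single_eq_same, ← Ideal.Quotient.mk_eq_mk,
      Submodule.mapQ_apply, LinearMap.mulLeft_apply, mul_one]
    rfl
  · intro k _ hk
    rw [LinearMap.comp_apply, LinearMap.proj_apply, Pi.single_eq_of_ne hk, map_zero]
  · simp

/-- The matrix of the multiplication by the variable. -/
def shiftMatrix (e : ι → ℕ) (P : ι → R[X]) :
    Matrix (Σ i, Fin (e i)) (Σ i, Fin (e i)) R :=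
  blockMatrix e P fun j i => if j = i then X else 0

theorem shiftMatrix_eq (hP : ∀ i, (P i).Monic) (he : ∀ i, (P i).natDegree = e i) :
    shiftMatrix e P = LinearMap.toMatrix (piQuotBasis hP he) (piQuotBasis hP he)
      (((X : R[X]) • LinearMap.id : _ →ₗ[R[X]] _).restrictScalars R) := by
  refine (toMatrix_eq_blockMatrix hP he ((X : R[X]) • LinearMap.id) fun i j => ?_).symm
  rw [LinearMap.smul_apply, LinearMap.id_apply, Pi.smul_apply]
  by_cases h : j = i
  · subst h
    rw [Pi.single_eq_same, if_pos rfl, ← Ideal.Quotient.mk_eq_mk, ← Submodule.Quotient.mk_smul,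
      smul_eq_mul, mul_one]
    rfl
  · rw [Pi.single_eq_of_ne h, smul_zero, if_neg h, map_zero]

theorem commute_shiftMatrix (hP : ∀ i, (P i).Monic) (he : ∀ i, (P i).natDegree = e i)
    (G : ι → ι → R[X]) (hG : ∀ i j, P j ∣ G j i * P i) :
    Commute (shiftMatrix e P) (blockMatrix e P G) := by
  rw [shiftMatrix_eq hP he, ← toMatrix_blockHom hP he G hG, Commute, SemiconjBy,
    ← LinearMap.toMatrix_comp, ← LinearMap.toMatrix_comp]
  congr 1
  refine LinearMap.ext fun v => ?_
  exact ((blockHom G hG).map_smul X v).symm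

omit [Nontrivial R] in
theorem aeval_X_smul_id {M : Type*} [AddCommGroup M] [Module R M] [Module R[X] M]
    [IsScalarTower R R[X] M] (Q : R[X]) :
    aeval (((X : R[X]) • LinearMap.id : M →ₗ[R[X]] M).restrictScalars R) Q =
      (Q • LinearMap.id : M →ₗ[R[X]] M).restrictScalars R := by
  have h := aeval_algHom_apply (Algebra.lsmul R R M : R[X] →ₐ[R] _) X Q
  rw [aeval_X_left_apply] at h
  exact h

/-- `Q` of the shift is multiplication by `Q`, which is zero on every cyclic factor. -/
theorem aeval_shiftMatrix (hP : ∀ i, (P i).Monic) (he : ∀ i, (P i).natDegree = e i) {Q : R[X]}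
    (hQ : ∀ i, P i ∣ Q) : aeval (shiftMatrix e P) Q = 0 := by
  have h := aeval_algHom_apply (LinearMap.toMatrixAlgEquiv (piQuotBasis hP he)).toAlgHom
    (((X : R[X]) • LinearMap.id : _ →ₗ[R[X]] _).restrictScalars R) Q
  rw [aeval_X_smul_id] at h
  rw [shiftMatrix_eq hP he]
  refine h.trans ?_
  have h0 : ((Q • LinearMap.id : (∀ i, R[X] ⧸ Ideal.span {P i}) →ₗ[R[X]] _).restrictScalars R) =
      0 := by
    refine LinearMap.ext fun v => funext fun i => ?_
    obtain ⟨w, hw⟩ := Ideal.Quotient.mk_surjective (v i)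
    change Q • v i = 0
    rw [← hw, ← Ideal.Quotient.mk_eq_mk, ← Submodule.Quotient.mk_smul, Ideal.Quotient.mk_eq_mk,
      Ideal.Quotient.eq_zero_iff_dvd]
    exact (hQ i).mul_right w
  rw [h0, map_zero]

end BlockMatrix

end

/-! ### Splitting multiple roots while lifting homomorphisms -/

section

open Polynomial

section Lift

/-- The product of the factors `X - (c + s k)`, over the polynomial ring in `s`. -/
def stairs (c : ℂ) (S : Finset ℕ) : ℂ[X][X] :=
  ∏ k ∈ S, (X - C (C c + X * C (k : ℂ)))

theorem monic_stairs (c : ℂ) (S : Finset ℕ) : (stairs c S).Monic :=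
  monic_prod_of_monic _ _ fun _ _ => monic_X_sub_C _

theorem natDegree_stairs (c : ℂ) (S : Finset ℕ) : (stairs c S).natDegree = S.card :=
  natDegree_finsetProd_X_sub_C_eq_card S _

theorem stairs_map_evalRingHom (c : ℂ) (S : Finset ℕ) (s : ℂ) :
    (stairs c S).map (evalRingHom s) = ∏ k ∈ S, (X - C (c + s * k)) := by
  simp [stairs, Polynomial.map_prod]

theorem stairs_map_evalRingHom_zero (c : ℂ) (S : Finset ℕ) :
    (stairs c S).map (evalRingHom 0) = (X - C c) ^ S.card := by
  simp [stairs_map_evalRingHom]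

theorem map_C_map_evalRingHom (g : ℂ[X]) (s : ℂ) : (g.map C).map (evalRingHom s) = g := by
  rw [map_map]
  have : (evalRingHom s).comp C = RingHom.id ℂ := RingHom.ext fun a => by simp
  rw [this, Polynomial.map_id]

/-- A homomorphism of cyclic modules must remain one after the roots are spread out. If c = c', the
stairs are nested: for l ≤ k the constant lift of `g` works, and for k ≤ l the factor (X - c)^(l -
k) of `g` is replaced by the missing steps. If c ≠ c', coprimality makes (X - c')^l divide `g`, and
this factor is replaced by the whole stairs. -/
theorem exists_lift_of_dvd (c c' : ℂ) (k l : ℕ) {g : ℂ[X]}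
    (hg : (X - C c') ^ l ∣ g * (X - C c) ^ k) :
    ∃ G : ℂ[X][X], G.map (evalRingHom 0) = g ∧
      stairs c' (.range l) ∣ G * stairs c (.range k) := by
  by_cases hc : c = c'
  · subst hc
    rcases le_total l k with h | h
    · refine ⟨g.map C, map_C_map_evalRingHom g 0, Dvd.dvd.mul_left ?_ _⟩
      exact Finset.prod_dvd_prod_of_subset _ _ _ (Finset.range_subset_range.2 h)
    · obtain ⟨u, hu⟩ : (X - C c) ^ (l - k) ∣ g := by
        rw [← Nat.sub_add_cancel h, pow_add] at hg
        exact (mul_dvd_mul_iff_right (pow_ne_zero _ (X_sub_C_ne_zero c))).1 hg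
      refine ⟨stairs c (Finset.range l \ Finset.range k) * u.map C, ?_, u.map C, ?_⟩
      · rw [Polynomial.map_mul, map_C_map_evalRingHom, stairs_map_evalRingHom_zero, hu,
          Finset.card_sdiff_of_subset (Finset.range_subset_range.2 h)]
        simp
      · have : stairs c (.range l) =
            stairs c (Finset.range l \ Finset.range k) * stairs c (.range k) :=
          (Finset.prod_sdiff (Finset.range_subset_range.2 h)).symm
        rw [this]
        ring
  · obtain ⟨u, hu⟩ : (X - C c') ^ l ∣ g :=
      ((pairwise_coprime_X_sub_C Function.injective_id (Ne.symm hc)).pow (m := l)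
        (n := k)).dvd_of_dvd_mul_right hg
    refine ⟨stairs c' (.range l) * u.map C, ?_, Dvd.dvd.mul_right (dvd_mul_right _ _) _⟩
    rw [Polynomial.map_mul, map_C_map_evalRingHom, stairs_map_evalRingHom_zero, hu,
      Finset.card_range]

/-- For almost all values of the parameter, a product of stairs with distinct origins is
squarefree. -/
theorem eventually_squarefree_prod_stairs (A : Finset ℂ) (S : Finset ℕ) :
    ∀ᶠ s in Filter.cofinite,
      Squarefree ((∏ c ∈ A, stairs c S).map (evalRingHom s)) := by
  have h : ∀ᶠ s : ℂ in Filter.cofinite, ∀ p q : A × S, p ≠ q →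
      ((p.1 : ℂ) + s * (p.2 : ℕ)) - (q.1 + s * (q.2 : ℕ)) ≠ 0 := by
    rw [Filter.eventually_all]
    intro p
    rw [Filter.eventually_all]
    intro q
    by_cases hpq : p = q
    · simp [hpq]
    · have hne : (C ((p.1 : ℂ) - q.1) + X * C (((p.2 : ℕ) : ℂ) - (q.2 : ℕ))) ≠ 0 := by
        intro h0
        have h1 := congrArg (eval 0) h0
        have h2 := congrArg (coeff · 1) h0
        simp [sub_eq_zero] at h1 h2
        exact hpq (Prod.ext h1 h2)
      filter_upwards [eventually_eval_ne_zero hne] with s hs _ h0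
      apply hs
      rw [← h0]
      simp
      ring
  filter_upwards [h] with s hs
  have hinj : Function.Injective fun p : A × S => (p.1 : ℂ) + s * (p.2 : ℕ) := by
    intro p q hpq
    by_contra hne
    exact hs p q hne (sub_eq_zero.2 hpq)
  have h1 := (separable_prod_X_sub_C_iff.2 hinj).squarefree
  convert h1
  rw [Polynomial.map_prod, Fintype.prod_prod_type, Finset.prod_coe_sort_eq_attach,
    ← Finset.prod_attach]
  refine Finset.prod_congr rfl fun c _ => ?_
  rw [stairs_map_evalRingHom, Finset.prod_coe_sort S fun k => X - C ((c : ℂ) + s * (k : ℂ))]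

end Lift

section Decomposition

variable {n : ℕ}

/-- In a suitable basis, a complex matrix is the multiplication by the variable in a product of
cyclic modules, and the commuting matrices are the endomorphisms of this module. -/
theorem exists_basis_toMatrix_eq_blockMatrix (x : Matrix (Fin n) (Fin n) ℂ) :
    ∃ (ι : Type) (_ : Fintype ι) (_ : DecidableEq ι) (c : ι → ℂ) (e : ι → ℕ)
      (b : Module.Basis (Σ i, Fin (e i)) ℂ (Fin n → ℂ)),
      LinearMap.toMatrix b b (Matrix.toLin' x) = shiftMatrix e (fun i => (X - C (c i)) ^ e i) ∧
      ∀ y, Commute x y → ∃ G : ι → ι → ℂ[X],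
        (∀ i j, (X - C (c j)) ^ e j ∣ G j i * (X - C (c i)) ^ e i) ∧
        LinearMap.toMatrix b b (Matrix.toLin' y) =
          blockMatrix e (fun i => (X - C (c i)) ^ e i) G := by
  classical
  set φ := Matrix.toLin' x with hφ
  have htors : Module.IsTorsion ℂ[X] (Module.AEval' φ) :=
    Module.AEval.isTorsion_of_finiteDimensional ℂ (Fin n → ℂ) φ
  -- Structure theorem over the principal ideal domain ℂ[X]; over ℂ the irreducible `p i` are linear
  -- up to units.
  obtain ⟨ι, hι, p, hp, e, ⟨Φ₀⟩⟩ := Module.equiv_directSum_of_isTorsion htors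
  have hroot : ∀ i, ∃ c, Ideal.span {p i} = Ideal.span {(X - C c : ℂ[X])} := by
    intro i
    obtain ⟨c, hc⟩ := exists_root_of_degree_eq_one (IsAlgClosed.degree_eq_one_of_irreducible ℂ (hp i))
    refine ⟨c, Ideal.span_singleton_eq_span_singleton.2 ?_⟩
    exact ((irreducible_X_sub_C c).associated_of_dvd (hp i) (dvd_iff_isRoot.2 hc)).symm
  choose c hc using hroot
  have hspan : ∀ i, (Submodule.span ℂ[X] {p i ^ e i}) =
      (Ideal.span {(X - C (c i)) ^ e i} : Ideal ℂ[X]) := by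
    intro i
    change Ideal.span {p i ^ e i} = _
    rw [← Ideal.span_singleton_pow, hc, Ideal.span_singleton_pow]
  set P : ι → ℂ[X] := fun i => (X - C (c i)) ^ e i with hPdef
  have hP : ∀ i, (P i).Monic := fun i => (monic_X_sub_C _).pow _
  have he : ∀ i, (P i).natDegree = e i := fun i => by
    rw [natDegree_pow, natDegree_X_sub_C, mul_one]
  let Φ : Module.AEval' φ ≃ₗ[ℂ[X]] (∀ i, ℂ[X] ⧸ Ideal.span {P i}) :=
    Φ₀ ≪≫ₗ DirectSum.linearEquivFunOnFintype ℂ[X] ι _ ≪≫ₗ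
      LinearEquiv.piCongrRight fun i => Submodule.quotEquivOfEq _ _ (hspan i)
  let Ψ : (Fin n → ℂ) ≃ₗ[ℂ] (∀ i, ℂ[X] ⧸ Ideal.span {P i}) :=
    Module.AEval'.of φ ≪≫ₗ Φ.restrictScalars ℂ
  have hΨ : ∀ v, Ψ (φ v) = (X : ℂ[X]) • Ψ v := by
    intro v
    change Φ (Module.AEval'.of φ (φ v)) = X • Φ (Module.AEval'.of φ v)
    rw [← Module.AEval'.X_smul_of, map_smul]
  have hmat : ∀ (f : (Fin n → ℂ) →ₗ[ℂ] (Fin n → ℂ))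
      (Y : (∀ i, ℂ[X] ⧸ Ideal.span {P i}) →ₗ[ℂ[X]] (∀ i, ℂ[X] ⧸ Ideal.span {P i})),
      (∀ v, Ψ (f v) = Y (Ψ v)) →
      LinearMap.toMatrix ((piQuotBasis hP he).map Ψ.symm) ((piQuotBasis hP he).map Ψ.symm) f =
        LinearMap.toMatrix (piQuotBasis hP he) (piQuotBasis hP he) (Y.restrictScalars ℂ) := by
    intro f Y hfY
    ext i j
    rw [LinearMap.toMatrix_apply, LinearMap.toMatrix_apply, Module.Basis.map_repr,
      Module.Basis.map_apply, LinearEquiv.trans_apply, LinearEquiv.symm_symm, hfY,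
      LinearEquiv.apply_symm_apply]
    rfl
  refine ⟨ι, hι, inferInstance, c, e, (piQuotBasis hP he).map Ψ.symm, ?_, fun y hy => ?_⟩
  · rw [shiftMatrix_eq hP he]
    exact hmat φ _ hΨ
  · have hcomm : ∀ v, φ (Matrix.toLin' y v) = Matrix.toLin' y (φ v) := by
      intro v
      simp only [hφ, Matrix.toLin'_apply, Matrix.mulVec_mulVec, hy.eq]
    let Y₀ : Module.AEval' φ →ₗ[ℂ[X]] Module.AEval' φ :=
      LinearMap.ofAEval φ ((Module.AEval'.of φ).toLinearMap ∘ₗ Matrix.toLin' y) (by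
        intro v
        change Module.AEval'.of φ (Matrix.toLin' y (φ v)) = _
        rw [← hcomm, ← Module.AEval'.X_smul_of]
        rfl)
    let Y := Φ.toLinearMap ∘ₗ Y₀ ∘ₗ Φ.symm.toLinearMap
    obtain ⟨G, hG, hG'⟩ := exists_toMatrix_eq_blockMatrix hP he Y
    refine ⟨G, hG, ?_⟩
    rw [← hG']
    refine hmat _ Y fun v => ?_
    change _ = Φ (Y₀ (Φ.symm (Φ (Module.AEval'.of φ v))))
    rw [LinearEquiv.symm_apply_apply]
    rfl

end Decomposition

end

/-! ### Deformation to diagonalizable matrices and density of the strata -/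

section

open Polynomial

section Deformation

theorem aeval_mul_mul {R k m : Type*} [CommRing R] [Fintype k] [DecidableEq k] [Fintype m]
    [DecidableEq m] {g : Matrix m k R} {h : Matrix k m R} (hgh : g * h = 1) (hhg : h * g = 1)
    (M : Matrix k k R) (Q : R[X]) : aeval (g * M * h) Q = g * aeval M Q * h := by
  have hpow : ∀ j : ℕ, (g * M * h) ^ j = g * M ^ j * h := by
    intro j
    induction j with
    | zero => simp [hgh]
    | succ j ih =>
      calc (g * M * h) ^ (j + 1) = g * M ^ j * (h * g) * M * h := by
            rw [pow_succ, ih]; simp only [Matrix.mul_assoc]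
        _ = g * M ^ (j + 1) * h := by rw [hhg, pow_succ]; simp only [Matrix.mul_assoc, Matrix.mul_one]
  induction Q using Polynomial.induction_on' with
  | add p q hp hq => rw [map_add, map_add, hp, hq, Matrix.mul_add, Matrix.add_mul]
  | monomial j a =>
    rw [aeval_monomial, aeval_monomial, hpow, Algebra.algebraMap_eq_smul_one,
      Algebra.algebraMap_eq_smul_one, smul_mul_assoc, smul_mul_assoc, one_mul, one_mul,
      Matrix.mul_smul, Matrix.smul_mul]

theorem shiftMatrix_map {R S ι : Type*} [CommRing R] [CommRing S] [DecidableEq ι] (φ : R →+* S)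
    (e : ι → ℕ) {P : ι → R[X]} (hP : ∀ i, (P i).Monic) :
    (shiftMatrix e P).map φ = shiftMatrix e fun i => (P i).map φ := by
  rw [shiftMatrix, blockMatrix_map φ e hP]
  congr 1
  ext1 j
  ext1 i
  split_ifs <;> simp

variable {n : ℕ}

/-- A matrix is the special value of a polynomial family of matrices, whose general member is
diagonalizable, to which all commuting matrices extend. -/
theorem exists_deformation (x : Matrix (Fin n) (Fin n) ℂ) :
    ∃ x' : Matrix (Fin n) (Fin n) ℂ[X], x'.evalAt 0 = x ∧
      (∀ᶠ s in Filter.cofinite, ∃ Q : ℂ[X], Squarefree Q ∧ aeval (x'.evalAt s) Q = 0) ∧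
      ∀ y, Commute x y → ∃ y' : Matrix (Fin n) (Fin n) ℂ[X], y'.evalAt 0 = y ∧
        Commute x' y' := by
  obtain ⟨ι, _, _, c, e, b, hx, hy⟩ := exists_basis_toMatrix_eq_blockMatrix x
  let P : ι → ℂ[X][X] := fun i => stairs (c i) (.range (e i))
  have hP : ∀ i, (P i).Monic := fun i => monic_stairs _ _
  have he : ∀ i, (P i).natDegree = e i := fun i => by
    rw [natDegree_stairs, Finset.card_range]
  have hP0 : ∀ i, (P i).map (evalRingHom 0) = (X - C (c i)) ^ e i := fun i => by
    rw [stairs_map_evalRingHom_zero, Finset.card_range]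
  let g := (Pi.basisFun ℂ (Fin n)).toMatrix b
  let h := b.toMatrix (Pi.basisFun ℂ (Fin n))
  have hgh : g * h = 1 := Module.Basis.toMatrix_mul_toMatrix_flip _ _
  have hhg : h * g = 1 := Module.Basis.toMatrix_mul_toMatrix_flip _ _
  have hconj : ∀ y : Matrix (Fin n) (Fin n) ℂ,
      g * LinearMap.toMatrix b b (Matrix.toLin' y) * h = y := by
    intro y
    rw [basis_toMatrix_mul_linearMap_toMatrix_mul_basis_toMatrix, ← Matrix.toLin_eq_toLin',
      LinearMap.toMatrix_toLin]
  have hhg' : h.map C * g.map C = 1 := by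
    rw [← Matrix.map_mul, hhg, Matrix.map_one _ C.map_zero C.map_one]
  have heval : ∀ (M : Matrix (Σ i, Fin (e i)) (Σ i, Fin (e i)) ℂ[X]) (s : ℂ),
      (g.map C * M * h.map C).evalAt s = g * M.map (evalRingHom s) * h := by
    intro M s
    ext i j
    simp [Matrix.evalAt, Matrix.mul_apply, eval_finsetSum]
  refine ⟨g.map C * shiftMatrix e P * h.map C, ?_, ?_, fun y hxy => ?_⟩
  · rw [heval, shiftMatrix_map _ e hP]
    simp only [hP0]
    rw [← hx, hconj]
  · let A := Finset.univ.image c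
    -- Stairs long enough to be a multiple of every `P i`, with each origin taken once, so that the
    -- common multiple `Q` is squarefree for almost all s.
    let S := Finset.range (∑ i, e i)
    let Q : ℂ[X][X] := ∏ c ∈ A, stairs c S
    have hQ : ∀ i, P i ∣ Q := fun i =>
      (Finset.prod_dvd_prod_of_subset _ _ _ (Finset.range_subset_range.2
        (Finset.single_le_sum (fun _ _ => Nat.zero_le _) (Finset.mem_univ i)))).trans
      (Finset.dvd_prod_of_mem (fun c => stairs c S) (Finset.mem_image_of_mem c (Finset.mem_univ i)))
    filter_upwards [eventually_squarefree_prod_stairs A S] with s hs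
    refine ⟨_, hs, ?_⟩
    rw [heval, aeval_mul_mul hgh hhg]
    have h1 := map_aeval_eq_aeval_map (φ := evalRingHom s) (ψ := (evalRingHom s).mapMatrix)
      (RingHom.ext fun r => Matrix.ext fun i j => by
        simp only [RingHom.comp_apply, RingHom.mapMatrix_apply, Matrix.map_apply,
          Matrix.algebraMap_matrix_apply]
        split_ifs <;> simp) Q (shiftMatrix e P)
    rw [aeval_shiftMatrix hP he hQ, map_zero] at h1
    have h2 : aeval ((shiftMatrix e P).map (evalRingHom s)) (Q.map (evalRingHom s)) = 0 := h1.symm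
    rw [h2, Matrix.mul_zero, Matrix.zero_mul]
  · obtain ⟨G, hG, hG'⟩ := hy y hxy
    -- Lifting the components one by one suffices, since the divisibilities alone make `blockMatrix
    -- e P G'` commute with the deformed shift.
    choose G' hG0 hGdvd using fun j i => exists_lift_of_dvd _ _ _ _ (hG i j)
    refine ⟨g.map C * blockMatrix e P G' * h.map C, ?_, ?_⟩
    · rw [heval, blockMatrix_map _ e hP]
      simp only [hP0, hG0]
      rw [← hG', hconj]
    · have h1 := (commute_shiftMatrix hP he G' fun i j => hGdvd j i).eq
      have h2 : ∀ M N : Matrix (Σ i, Fin (e i)) (Σ i, Fin (e i)) ℂ[X],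
          (g.map C * M * h.map C) * (g.map C * N * h.map C) = g.map C * (M * N) * h.map C := by
        intro M N
        calc _ = g.map C * M * (h.map C * g.map C) * N * h.map C := by
              simp only [Matrix.mul_assoc]
          _ = _ := by rw [hhg', Matrix.mul_one]; simp only [Matrix.mul_assoc]
      rw [Commute, SemiconjBy, h2, h2, h1]

/-- The partition whose parts are the cardinalities of the fibres. -/
theorem exists_partition_parts_eq_fiberCards {α : Type*} [DecidableEq α] (d : Fin n → α) :
    ∃ μ : n.Partition, μ.parts = fiberCards d := by
  refine ⟨⟨fiberCards d, fun {i} hi => ?_, ?_⟩, rfl⟩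
  · obtain ⟨a, ha, rfl⟩ := Multiset.mem_map.1 hi
    rw [Finset.mem_val] at ha
    obtain ⟨j, -, rfl⟩ := Finset.mem_image.1 ha
    exact Finset.card_pos.2 ⟨j, by simp⟩
  · have := Finset.card_eq_sum_card_image d Finset.univ
    rw [Finset.card_univ, Fintype.card_fin] at this
    exact this.symm

end Deformation

namespace CotGl

variable {n : ℕ}

/-- The strata are dense. -/
theorem lambda_subset_closure_iUnion_stratum :
    Lambda n ⊆ closure (⋃ μ : n.Partition, stratum μ) := by
  rintro p ⟨y, z, hy, hz, hp⟩
  obtain ⟨x', hx0, hx', hext⟩ := exists_deformation p.base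
  obtain ⟨y', hy0, hy'⟩ := hext y ((commute_iff_lie_eq).2 hy)
  obtain ⟨z', hz0, hz'⟩ := hext z ((commute_iff_lie_eq).2 hz)
  rw [mem_closure_iff]
  intro f hf
  have hlie : ∀ s, (⁅y', z'⁆).evalAt s = ⁅y'.evalAt s, z'.evalAt s⁆ := by
    intro s
    exact map_sub ((evalRingHom s).mapMatrix) _ _ |>.trans (by rw [map_mul, map_mul]; rfl)
  have hcomm : ∀ {w : Matrix (Fin n) (Fin n) ℂ[X]} (s : ℂ), Commute x' w →
      ⁅x'.evalAt s, w.evalAt s⁆ = 0 := by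
    intro w s hw
    exact commute_iff_lie_eq.1 (hw.map (evalRingHom s).mapMatrix)
  -- The curve (x', [y', z']) stays in Λ. Almost all its points lie in strata, possibly of a
  -- partition depending on s, and its point at 0 is `p`.
  have key := eval_eq_zero_of_eventually (x := x') (t := ⁅y', z'⁆) (f := f) (by
    filter_upwards [hx'] with s hs
    obtain ⟨Q, hQ, hQ0⟩ := hs
    obtain ⟨g, d, hg, hd⟩ := Matrix.exists_eq_conj_diagonal_of_squarefree _ hQ hQ0
    obtain ⟨μ, hμ⟩ := exists_partition_parts_eq_fiberCards d
    refine mem_ideal.1 hf _ (Set.mem_iUnion.2 ⟨μ, ?_, ?_⟩)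
    · exact ⟨y'.evalAt s, z'.evalAt s, hcomm s hy', hcomm s hz', hlie s⟩
    · exact isDiagonalizableOfType_iff.2 ⟨g, d, hg, hd, hμ.symm⟩) 0
  rw [hx0, hlie, hy0, hz0, ← hp] at key
  exact key

theorem lambda_subset_iUnion_closure_stratum :
    Lambda n ⊆ ⋃ μ : n.Partition, closure (stratum μ) := by
  rw [← closure_iUnion_of_finite]
  exact lambda_subset_closure_iUnion_stratum

end CotGl

end

/-! ### The irreducible components -/

section

open MvPolynomial

/-- An element of `J` outside `I` is a nonzerodivisor modulo the prime `I`, so dividing by it would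
lower the finite dimension. -/
theorem Ideal.eq_of_le_of_ringKrullDim_quotient_eq {R : Type*} [CommRing R] {I J : Ideal R}
    [I.IsPrime] (h : I ≤ J) {N : ℕ} (hI : ringKrullDim (R ⧸ I) = N)
    (hJ : ringKrullDim (R ⧸ J) = N) : I = J := by
  refine le_antisymm h fun r hr => ?_
  by_contra hrI
  have h1 := ringKrullDim_succ_le_of_surjective (Ideal.Quotient.factor h)
    (Ideal.Quotient.factor_surjective h) (r := Ideal.Quotient.mk I r)
    (mem_nonZeroDivisors_of_ne_zero (mt Ideal.Quotient.eq_zero_iff_mem.1 hrI))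
    (Ideal.Quotient.eq_zero_iff_mem.2 hr)
  rw [hI, hJ] at h1
  have h2 : N + 1 ≤ N := by exact_mod_cast h1
  omega

namespace CotGl

variable {n : ℕ}

theorem dim_congr {Z Z' : Set (CotGl n)} (h : ideal Z = ideal Z') : dim Z = dim Z' := by
  rw [dim, dim, h]

theorem ideal_image_closure_lambdaStratum (μ : n.Partition) :
    ideal (Subtype.val '' closure (LambdaStratum μ)) = ideal (stratum μ) := by
  rw [ideal_image_closure, image_lambdaStratum]

theorem isPrime_ideal_stratum (μ : n.Partition) : (ideal (stratum μ)).IsPrime := by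
  obtain ⟨b, hb, hμ⟩ := exists_idempotent_fiberCards μ
  rw [← ideal_genericBlockFamily hb hμ]
  exact isPrime_ideal_genericBlockFamily b

theorem exists_dense_isotropic (μ : n.Partition) : ∃ G : Set (CotGl n),
    ideal G = ideal (stratum μ) ∧ ∀ q ∈ G, ∃ W ≤ tangentSpace (stratum μ) q,
      n ^ 2 ≤ Module.finrank ℂ W ∧ ∀ v ∈ W, ∀ w ∈ W, symplecticForm v w = 0 := by
  obtain ⟨b, hb, hμ⟩ := exists_idempotent_fiberCards μ
  have h1 := ideal_genericBlockFamily hb hμ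
  have h2 := ideal_eq_of_subset_closure (genericBlockFamily_subset b) (blockFamily_subset_closure b)
  refine ⟨genericBlockFamily b, h1, fun q hq => ?_⟩
  rw [tangentSpace_congr (h1.symm.trans h2.symm)]
  exact exists_isotropic_le_tangentSpace hb hq

theorem dim_stratum (μ : n.Partition) : dim (stratum μ) = ((n ^ 2 : ℕ) : WithBot ℕ∞) := by
  apply le_antisymm
  · obtain ⟨b, hb, hμ⟩ := exists_idempotent_fiberCards μ
    have h1 := ideal_genericBlockFamily hb hμ
    have h2 := ideal_eq_of_subset_closure (genericBlockFamily_subset b)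
      (blockFamily_subset_closure b)
    rw [dim_congr (h1.symm.trans h2.symm)]
    exact dim_blockFamily_le hb
  · obtain ⟨G, hG, hW⟩ := exists_dense_isotropic μ
    rw [← dim_congr hG]
    refine le_dim_of_le_finrank_tangentSpace (hG ▸ isPrime_ideal_stratum μ) fun q hq => ?_
    obtain ⟨W, hWle, hWdim, -⟩ := hW q hq
    rw [tangentSpace_congr hG]
    exact hWdim.trans (Submodule.finrank_mono hWle)

/-- Both ideals have quotients of dimension n², and that of `ν` is prime, so the inclusion is an
equality; the closure determines the partition. -/
theorem eq_of_closure_lambdaStratum_subset {μ ν : n.Partition}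
    (h : closure (LambdaStratum μ) ⊆ closure (LambdaStratum ν)) : μ = ν := by
  have h1 := ideal_anti (Set.image_mono (f := Subtype.val) h)
  rw [ideal_image_closure_lambdaStratum, ideal_image_closure_lambdaStratum] at h1
  have := isPrime_ideal_stratum ν
  have h2 := Ideal.eq_of_le_of_ringKrullDim_quotient_eq h1 (dim_stratum ν) (dim_stratum μ)
  exact eq_of_stratum_subset_closure (subset_closure_iff.2 h2.ge) (subset_closure_iff.2 h2.le)

theorem isIrreducible_closure_lambdaStratum (μ : n.Partition) :
    IsIrreducible (closure (LambdaStratum μ)) :=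
  isIrreducible_closure_of_isPrime _ _ (image_lambdaStratum μ ▸ isPrime_ideal_stratum μ)

theorem exists_subset_closure_lambdaStratum {T : Set (Lambda n)} (hT : IsIrreducible T) :
    ∃ μ : n.Partition, T ⊆ closure (LambdaStratum μ) := by
  classical
  obtain ⟨z, hz, hTz⟩ := isIrreducible_iff_sUnion_isClosed.1 hT
    (Finset.univ.image fun μ : n.Partition => closure (LambdaStratum μ))
    (fun z hz => by
      obtain ⟨μ, -, rfl⟩ := Finset.mem_image.1 hz
      exact isClosed_closure)
    (fun p _ => by
      obtain ⟨μ, hμ⟩ := Set.mem_iUnion.1 (lambda_subset_iUnion_closure_stratum p.2)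
      refine Set.mem_sUnion.2 ⟨closure (LambdaStratum μ), by simp, closure_subtype.2 ?_⟩
      rwa [image_lambdaStratum])
  obtain ⟨μ, -, rfl⟩ := Finset.mem_image.1 hz
  exact ⟨μ, hTz⟩

/-- Finitely many irreducible closed sets cover Λ, so every irreducible subset lies in one of them;
as no two distinct ones are nested, each is maximal. -/
theorem irreducibleComponents_lambda (n : ℕ) :
    irreducibleComponents (Lambda n) =
      Set.range fun μ : n.Partition => closure (LambdaStratum μ) := by
  ext T
  constructor
  · intro hT
    obtain ⟨μ, hμ⟩ := exists_subset_closure_lambdaStratum hT.1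
    exact ⟨μ, (hT.eq_of_subset (isIrreducible_closure_lambdaStratum μ) hμ).symm⟩
  · rintro ⟨μ, rfl⟩
    refine ⟨isIrreducible_closure_lambdaStratum μ, fun T hT hμT => ?_⟩
    obtain ⟨ν, hν⟩ := exists_subset_closure_lambdaStratum hT
    obtain rfl := eq_of_closure_lambdaStratum_subset (hμT.trans hν)
    exact hν

theorem isIsotropic_closure_lambdaStratum (μ : n.Partition) :
    IsIsotropic (Subtype.val '' closure (LambdaStratum μ)) := by
  obtain ⟨G, hG, hW⟩ := exists_dense_isotropic μ
  have h := ideal_image_closure_lambdaStratum μ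
  refine isIsotropic_of_ideal_eq (hG.trans h.symm) ((dim_congr h).trans (dim_stratum μ))
    fun q hq => ?_
  rw [tangentSpace_congr h]
  exact hW q hq

end CotGl

end

end

theorem mainTheorem9 (n : ℕ) :
    irreducibleComponents (CotGl.Lambda n) =
        Set.range (fun μ : n.Partition => closure (CotGl.LambdaStratum μ)) ∧
      Function.Injective (fun μ : n.Partition => closure (CotGl.LambdaStratum μ)) ∧
      (∀ μ : n.Partition,
        CotGl.dim (Subtype.val '' closure (CotGl.LambdaStratum μ)) =
          ((n ^ 2 : ℕ) : WithBot ℕ∞)) ∧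
      CotGl.IsLagrangian (CotGl.Lambda n) := by
  have hdim : ∀ μ : n.Partition,
      CotGl.dim (Subtype.val '' closure (CotGl.LambdaStratum μ)) =
        ((n ^ 2 : ℕ) : WithBot ℕ∞) := fun μ =>
    (CotGl.dim_congr (CotGl.ideal_image_closure_lambdaStratum μ)).trans (CotGl.dim_stratum μ)
  refine ⟨CotGl.irreducibleComponents_lambda n,
    fun μ ν h => CotGl.eq_of_closure_lambdaStratum_subset h.le, hdim, fun C hC => ?_⟩
  rw [CotGl.irreducibleComponents_lambda] at hC
  obtain ⟨μ, rfl⟩ := hC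
  exact ⟨CotGl.isIsotropic_closure_lambdaStratum μ, hdim μ⟩
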